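/- Let $\mathbb D=\{z\in\mathbb C:|z|<1\}$. Let $\mathcal C_1$ be the class of analytic functions $f$ on $\mathbb D$ of the form $f(z)=z+\sum_{n\ge 2}a_nz^n$ for which there is a convex function $g$ (that is, $g$ is analytic and univalent on $\mathbb D$ and $g(\mathbb D)$ is a convex set) of the form $g(z)=b_1z+b_2z^2+\cdots$ with $\operatorname{Re} b_1>0$, such that $\operatorname{Re}\left(\frac{zf'(z)}{g(z)}\right)>0$ for all $z\in\mathbb D$ (the quotient at $z=0$ being understood as its limit $1/b_1$). Let $d(f(0),\partial f(\mathbb D))$ denote the Euclidean distance from $f(0)=0$ to the boundary of $f(\mathbb D)$. Let $N\ge 2$ be an integer. Then the equation $$\left(\frac{2r}{1-r}+\log(1-r)\right)^2+\sum_{n=N}^{\infty}\left(2-\frac1n\right)r^n=1-\log 2$$ has exactly one root $r=r_{2,N}$ in $(0,1)$, and for every $f\in\mathcal C_1$, $$|f(z)|^2+\sum_{n=N}^{\infty}|a_n|\,|z|^n\le d\bigl(f(0),\partial f(\mathbb D)\bigr)\qquad\text{for } |z|\le r_{2,N},$$ where the series converges. The radius $r_{2,N}$ is sharp: there is a function $f\in\mathcal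 C_1$ for which equality holds at some $z$ with $|z|=r_{2,N}$, and for which, for every $\rho\in(r_{2,N},1)$, the inequality fails at some $z$ with $|z|=\rho$. -/

import Mathlib

namespace BohrRogosinski

/-- The open unit disc. -/
def unitDisc : Set ℂ := Metric.ball 0 1

/-- A convex function `g(z) = b₁ z + ...` with `Re b₁ > 0`: analytic and univalent in the unit
disc, vanishing at the origin, with a convex image. -/
structure IsConvexFunction (g : ℂ → ℂ) : Prop where
  analytic : DifferentiableOn ℂ g unitDisc
  univalent : Set.InjOn g unitDisc
  convex_image : Convex ℝ (g '' unitDisc)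
  map_zero : g 0 = 0
  re_deriv_zero_pos : 0 < (deriv g 0).re

/-- The class `C₁`, normalized by `f(z) = z + ∑_{n ≥ 2} aₙ zⁿ`: there is a convex function `g`
with `Re (z f'(z) / g(z)) > 0` in the unit disc. At `z = 0` the quotient has a removable
singularity with value `f'(0) / g'(0) = 1 / b₁`, whose real part is automatically positive, so
the condition is written for `z ≠ 0`. -/
structure IsClassC1 (f : ℂ → ℂ) : Prop where
  analytic : DifferentiableOn ℂ f unitDisc
  map_zero : f 0 = 0
  deriv_zero : deriv f 0 = 1
  exists_convex : ∃ g : ℂ → ℂ, IsConvexFunction g ∧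
    ∀ z ∈ unitDisc, z ≠ 0 → 0 < (z * deriv f z / g z).re

/-- The `n`-th Taylor coefficient of `f` at the origin. -/
noncomputable def taylorCoeff (f : ℂ → ℂ) (n : ℕ) : ℂ :=
  iteratedDeriv n f 0 / (n.factorial : ℂ)

/-- `|f(z)|² + ∑_{n ≥ N} |aₙ| |z|ⁿ`. -/
noncomputable def bohrRogosinskiSum (f : ℂ → ℂ) (N : ℕ) (z : ℂ) : ℝ :=
  ‖f z‖ ^ 2 + ∑' k : ℕ, ‖taylorCoeff f (N + k)‖ * ‖z‖ ^ (N + k)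

/-- The Euclidean distance `d(f(0), ∂f(𝔻))`. -/
noncomputable def boundaryDist (f : ℂ → ℂ) : ℝ :=
  Metric.infDist (f 0) (frontier (f '' unitDisc))

/-- The equation
`(2r/(1-r) + log(1-r))² + ∑_{n ≥ N} (2 - 1/n) rⁿ = 1 - log 2` for the radius. -/
def IsRadiusEquation (N : ℕ) (r : ℝ) : Prop :=
  (2 * r / (1 - r) + Real.log (1 - r)) ^ 2
      + ∑' k : ℕ, (2 - 1 / ((N + k : ℕ) : ℝ)) * r ^ (N + k)
    = 1 - Real.log 2

end BohrRogosinski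

namespace BohrRogosinski

open Complex Metric Set Filter Topology

/-! Everything rests on the factorization f'(z) = (g(z)/z) p(z), where Re p > 0 and b₁ p(0) = 1
(`IsClassC1.exists_factorization`).

Upper side: the coefficients of g are at most |b₁| and the nonconstant ones of p at most 2 Re p(0).
Convolving them gives |aₙ| ≤ 2 - 1/n (`IsClassC1.norm_taylorCoeff_le`), so |f(z)| ≤ 2r/(1-r) +
log(1-r) for r = |z|, and the Bohr–Rogosinski sum is bounded by the strictly increasing
`radiusFunction N r`.

Lower side: |g(z)/z| ≥ |b₁|/(1+r), which follows from starlikeness of order 1/2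
(`IsConvexUnivalent.half_le_re`) and the Koebe transform, together with |p(z)| ≥ |p(0)|(1-r)/(1+r),
gives |f'(z)| ≥ (1-r)/(1+r)². The integral of this bound over [0,1] is 1 - log 2, so the image
covers the disc of that radius (`ball_subset_image`). For this to bound the boundary distance the
boundary must be nonempty. That follows from Liouville's theorem once f is univalent, which
`injOn_of_re_pos` proves by deforming f to g.

Both sides are sharp for `extremal`: its coefficients are exactly 2 - 1/n, and its boundary value at
-1 is -(1 - log 2). -/

/-! ### Power series in the unit disc and averaging over roots of unity. -/

lemma hasSum_taylorCoeff {f : ℂ → ℂ} (hf : DifferentiableOn ℂ f unitDisc) {z : ℂ}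
    (hz : z ∈ unitDisc) : HasSum (fun n => taylorCoeff f n * z ^ n) (f z) := by
  have h := hasSum_taylorSeries_on_ball hf hz
  refine h.congr_fun ?_
  intro n
  simp only [taylorCoeff, smul_eq_mul, sub_zero]
  field_simp

/-- A function which is the sum of a power series in the unit disc has that power series. -/
lemma hasFPowerSeriesOnBall_ofScalars {c : ℕ → ℂ} {f : ℂ → ℂ}
    (h : ∀ z ∈ unitDisc, HasSum (fun n => c n * z ^ n) (f z)) :
    HasFPowerSeriesOnBall f (FormalMultilinearSeries.ofScalars ℂ c) 0 1 where
  r_le := by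
    refine ENNReal.le_of_forall_nnreal_lt fun r hr => ?_
    have hr1 : (r : ℝ) < 1 := by exact_mod_cast hr
    apply FormalMultilinearSeries.le_radius_of_tendsto (l := 0)
    have hs := (h (r : ℂ) (by simpa [unitDisc] using hr1)).summable.tendsto_atTop_zero.norm
    simpa [FormalMultilinearSeries.ofScalars_norm] using hs
  r_pos := one_pos
  hasSum := by
    intro y hy
    have hy' : y ∈ unitDisc := by
      simpa [unitDisc, ← ofReal_norm] using hy
    simpa [FormalMultilinearSeries.ofScalars_apply_eq, mul_comm] using h y hy'

lemma differentiableOn_of_hasSum {c : ℕ → ℂ} {f : ℂ → ℂ}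
    (h : ∀ z ∈ unitDisc, HasSum (fun n => c n * z ^ n) (f z)) :
    DifferentiableOn ℂ f unitDisc := by
  have := (hasFPowerSeriesOnBall_ofScalars h).differentiableOn
  have he : eball (0 : ℂ) 1 = unitDisc := by
    ext z; simp [unitDisc, ← ofReal_norm]
  rwa [he] at this

lemma taylorCoeff_eq_of_hasSum {c : ℕ → ℂ} {f : ℂ → ℂ}
    (h : ∀ z ∈ unitDisc, HasSum (fun n => c n * z ^ n) (f z)) (n : ℕ) :
    taylorCoeff f n = c n := by
  have h1 := (hasFPowerSeriesOnBall_ofScalars h).hasFPowerSeriesAt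
  have h2 := (hasFPowerSeriesOnBall_ofScalars
    (fun z hz => hasSum_taylorCoeff (differentiableOn_of_hasSum h) hz)).hasFPowerSeriesAt
  have := h2.eq_formalMultilinearSeries h1
  exact congrFun (FormalMultilinearSeries.ofScalars_series_injective ℂ ℂ this) n

lemma taylorCoeff_zero (f : ℂ → ℂ) : taylorCoeff f 0 = f 0 := by simp [taylorCoeff]

lemma taylorCoeff_one (f : ℂ → ℂ) : taylorCoeff f 1 = deriv f 0 := by simp [taylorCoeff]

lemma taylorCoeff_deriv (f : ℂ → ℂ) (n : ℕ) :
    taylorCoeff (deriv f) n = (n + 1) * taylorCoeff f (n + 1) := by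
  have h : (n.factorial : ℂ) ≠ 0 := by exact_mod_cast n.factorial_ne_zero
  have h' : ((n : ℂ) + 1) ≠ 0 := by exact_mod_cast n.succ_ne_zero
  simp only [taylorCoeff, iteratedDeriv_succ', Nat.factorial_succ]
  push_cast
  field_simp

lemma taylorCoeff_mul {u v : ℂ → ℂ} (hu : DifferentiableOn ℂ u unitDisc)
    (hv : DifferentiableOn ℂ v unitDisc) (n : ℕ) :
    taylorCoeff (fun z => u z * v z) n =
      ∑ k ∈ Finset.range (n + 1), taylorCoeff u k * taylorCoeff v (n - k) := by
  refine taylorCoeff_eq_of_hasSum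
    (c := fun n => ∑ k ∈ Finset.range (n + 1), taylorCoeff u k * taylorCoeff v (n - k)) ?_ n
  intro z hz
  have h1 := hasSum_taylorCoeff hu hz
  have h2 := hasSum_taylorCoeff hv hz
  have h3 := hasSum_sum_range_mul_of_summable_norm h1.summable.norm h2.summable.norm
  rw [h1.tsum_eq, h2.tsum_eq] at h3
  refine h3.congr_fun ?_
  intro m
  rw [Finset.sum_mul]
  refine Finset.sum_congr rfl fun k hk => ?_
  have : z ^ m = z ^ k * z ^ (m - k) := by
    rw [← pow_add]; congr 1; have := Finset.mem_range.1 hk; omega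
  rw [this]; ring

/-- Averaging a holomorphic function over the rotations by `n`-th roots of unity yields a
holomorphic function of `z ^ n`. -/
lemma exists_rotation_average {u : ℂ → ℂ} (hu : DifferentiableOn ℂ u unitDisc) {n : ℕ}
    (hn : n ≠ 0) : ∃ U : ℂ → ℂ, DifferentiableOn ℂ U unitDisc ∧ U 0 = u 0 ∧
      deriv U 0 = taylorCoeff u n ∧
      ∀ C : Set ℂ, Convex ℝ C → MapsTo u unitDisc C → MapsTo U unitDisc C := by
  have hinj : Function.Injective fun k : ℕ => n * k :=
    fun a b h => Nat.eq_of_mul_eq_mul_left (Nat.pos_of_ne_zero hn) h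
  have hroot : ∀ x ∈ unitDisc, ∃ z ∈ unitDisc, z ^ n = x := by
    intro x hx
    obtain ⟨z, hz⟩ := IsAlgClosed.exists_pow_nat_eq x (Nat.pos_of_ne_zero hn)
    refine ⟨z, ?_, hz⟩
    simp only [unitDisc, mem_ball_zero_iff] at hx ⊢
    rw [← hz, norm_pow] at hx
    exact (pow_lt_one_iff_of_nonneg (norm_nonneg _) hn).1 hx
  have hsum : ∀ x ∈ unitDisc, Summable fun k => taylorCoeff u (n * k) * x ^ k := by
    intro x hx
    obtain ⟨z, hz, rfl⟩ := hroot x hx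
    have := (hasSum_taylorCoeff hu hz).summable.comp_injective hinj
    refine this.congr fun k => ?_
    simp [pow_mul]
  have hU : ∀ x ∈ unitDisc, HasSum (fun k => taylorCoeff u (n * k) * x ^ k)
      (∑' k, taylorCoeff u (n * k) * x ^ k) := fun x hx => (hsum x hx).hasSum
  refine ⟨fun x => ∑' k, taylorCoeff u (n * k) * x ^ k, differentiableOn_of_hasSum hU, ?_, ?_, ?_⟩
  · refine (tsum_eq_single 0 ?_).trans ?_
    rotate_left
    · simp [taylorCoeff_zero]
    · intro k hk; simp [hk]
  · rw [← taylorCoeff_one, taylorCoeff_eq_of_hasSum hU]; simp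
  · intro C hC hm x hx
    obtain ⟨z, hz, rfl⟩ := hroot x hx
    obtain ⟨ω, hω⟩ : ∃ ω : ℂ, IsPrimitiveRoot ω n :=
      ⟨_, Complex.isPrimitiveRoot_exp n hn⟩
    have hω1 : ‖ω‖ = 1 := hω.norm'_eq_one hn
    have hmem : ∀ k : ℕ, ω ^ k * z ∈ unitDisc := by
      intro k; simpa [unitDisc, hω1] using hz
    have hn' : (n : ℂ) ≠ 0 := by exact_mod_cast hn
    -- Roots-of-unity filter: the average of u over the rotations ω ^ j z keeps only the exponents
    -- divisible by n. It exhibits U(z ^ n) as a convex combination of values of u.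
    have key : (∑' k, taylorCoeff u (n * k) * (z ^ n) ^ k) =
        ∑ j ∈ Finset.range n, ((n : ℝ)⁻¹) • u (ω ^ j * z) := by
      have h1 : HasSum (fun m => ∑ j ∈ Finset.range n,
          ((n : ℝ)⁻¹) • (taylorCoeff u m * (ω ^ j * z) ^ m))
          (∑ j ∈ Finset.range n, ((n : ℝ)⁻¹) • u (ω ^ j * z)) :=
        hasSum_sum fun j _ => (hasSum_taylorCoeff hu (hmem j)).const_smul _
      have h2 : ∀ m, (∑ j ∈ Finset.range n,
          ((n : ℝ)⁻¹) • (taylorCoeff u m * (ω ^ j * z) ^ m)) =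
          if n ∣ m then taylorCoeff u m * z ^ m else 0 := by
        intro m
        have h3 : ∀ j ∈ Finset.range n, ((n : ℝ)⁻¹) • (taylorCoeff u m * (ω ^ j * z) ^ m) =
            ((n : ℂ)⁻¹ * taylorCoeff u m * z ^ m) * (ω ^ m) ^ j := by
          intro j _
          simp only [Complex.real_smul, Complex.ofReal_inv, Complex.ofReal_natCast, mul_pow]
          rw [← pow_mul, ← pow_mul, mul_comm j m]; ring
        rw [Finset.sum_congr rfl h3, ← Finset.mul_sum]
        split_ifs with hd
        · rw [(hω.pow_eq_one_iff_dvd m).2 hd]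
          simp only [one_pow, Finset.sum_const, Finset.card_range, nsmul_eq_mul, mul_one]
          field_simp
        · have hne : ω ^ m ≠ 1 := fun h => hd ((hω.pow_eq_one_iff_dvd m).1 h)
          rw [geom_sum_eq hne, ← pow_mul, mul_comm m n, pow_mul, hω.pow_eq_one]
          simp
      simp only [h2] at h1
      rw [← h1.tsum_eq]
      have h4 : Function.support (fun m => if n ∣ m then taylorCoeff u m * z ^ m else 0) ⊆
          Set.range fun k : ℕ => n * k := by
        intro m hm
        by_cases hd : n ∣ m
        · obtain ⟨k, rfl⟩ := hd; exact ⟨k, rfl⟩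
        · simp [hd] at hm
      rw [← hinj.tsum_eq h4]
      refine tsum_congr fun k => ?_
      simp [pow_mul]
    simp only [key]
    refine hC.sum_mem (fun _ _ => by positivity) ?_ fun j _ => hm (hmem j)
    simp [hn]

/-! ### Functions of positive real part. -/

lemma isOpen_unitDisc : IsOpen unitDisc := isOpen_ball

lemma zero_mem_unitDisc : (0 : ℂ) ∈ unitDisc := by simp [unitDisc]

lemma mem_unitDisc {z : ℂ} : z ∈ unitDisc ↔ ‖z‖ < 1 := mem_ball_zero_iff

/-- The right half-plane lies on the side of a in the perpendicular bisector of a and its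
reflection; the squared norms differ by 4 Re w Re a. -/
lemma norm_sub_lt_norm_add_conj {w a : ℂ} (hw : 0 < w.re) (ha : 0 < a.re) :
    ‖w - a‖ < ‖w + (starRingEnd ℂ) a‖ := by
  rw [← sq_lt_sq₀ (norm_nonneg _) (norm_nonneg _), ← normSq_eq_norm_sq, ← normSq_eq_norm_sq]
  simp only [normSq_apply, sub_re, sub_im, add_re, add_im, conj_re, conj_im]
  nlinarith [mul_pos hw ha]

/-- The Schwarz lemma for maps of the unit disc into the right half-plane. -/
lemma norm_cayley_le {p : ℂ → ℂ} (hp : DifferentiableOn ℂ p unitDisc)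
    (hre : ∀ z ∈ unitDisc, 0 < (p z).re) :
    (∀ z ∈ unitDisc, ‖p z - p 0‖ ≤ ‖z‖ * ‖p z + (starRingEnd ℂ) (p 0)‖) ∧
      ‖deriv p 0‖ ≤ 2 * (p 0).re := by
  have h0 := hre 0 zero_mem_unitDisc
  -- The Cayley transform centred at p 0 maps the half-plane into the disc and gives V 0 = 0 and V'
  -- 0 = p' 0 / (2 Re p 0).
  set V : ℂ → ℂ := fun z => (p z - p 0) / (p z + (starRingEnd ℂ) (p 0)) with hVdef
  have hne : ∀ z ∈ unitDisc, p z + (starRingEnd ℂ) (p 0) ≠ 0 := by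
    intro z hz h
    have := norm_sub_lt_norm_add_conj (hre z hz) h0
    rw [h, norm_zero] at this
    exact absurd this (not_lt.2 (norm_nonneg _))
  have hV : DifferentiableOn ℂ V unitDisc := (hp.sub_const _).div (hp.add_const _) hne
  have hV0 : V 0 = 0 := by simp [V]
  have hmaps : MapsTo V (ball 0 1) (closedBall 0 1) := by
    intro z hz
    rw [mem_closedBall_zero_iff, norm_div]
    exact div_le_one_of_le₀ (norm_sub_lt_norm_add_conj (hre z hz) h0).le (norm_nonneg _)
  refine ⟨fun z hz => ?_, ?_⟩
  · have := norm_le_norm_of_mapsTo_ball hV hmaps hV0 (mem_unitDisc.1 hz)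
    rwa [norm_div, div_le_iff₀ (norm_pos_iff.2 (hne z hz))] at this
  · have h1 := norm_deriv_le_one_of_mapsTo_ball (c := 0) hV (by rwa [hV0]) one_pos
    have hd : HasDerivAt p (deriv p 0) 0 :=
      (hp.differentiableAt (isOpen_unitDisc.mem_nhds zero_mem_unitDisc)).hasDerivAt
    have hd2 := ((hd.sub_const (p 0)).div (hd.add_const ((starRingEnd ℂ) (p 0)))
      (hne 0 zero_mem_unitDisc)).deriv
    have he : V = (fun x => p x - p 0) / fun x => p x + (starRingEnd ℂ) (p 0) := rfl
    rw [he, hd2, sub_self, zero_mul, sub_zero, norm_div, norm_mul, norm_pow] at h1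
    have h2 : p 0 + (starRingEnd ℂ) (p 0) = ((2 * (p 0).re : ℝ) : ℂ) := by
      rw [add_conj]
    have h3 : ‖p 0 + (starRingEnd ℂ) (p 0)‖ = 2 * (p 0).re := by
      rw [h2, norm_real, Real.norm_of_nonneg (by positivity)]
    rw [h3, div_le_one (by positivity), sq] at h1
    exact le_of_mul_le_mul_right h1 (by positivity)

/-- Carathéodory's coefficient bound for functions of positive real part. -/
lemma norm_taylorCoeff_le_of_re_pos {p : ℂ → ℂ} (hp : DifferentiableOn ℂ p unitDisc)
    (hre : ∀ z ∈ unitDisc, 0 < (p z).re) {n : ℕ} (hn : n ≠ 0) :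
    ‖taylorCoeff p n‖ ≤ 2 * (p 0).re := by
  -- Averaging preserves the half-plane and turns the n-th coefficient into a first one, so the
  -- derivative bound at 0 suffices.
  obtain ⟨U, hU, hU0, hU1, hC⟩ := exists_rotation_average hp hn
  have hm : ∀ z ∈ unitDisc, 0 < (U z).re :=
    hC {w | 0 < w.re} (convex_halfSpace_re_gt 0) hre
  rw [← hU0, ← hU1]
  exact (norm_cayley_le hU hm).2

/-- The Schwarz estimate and the triangle inequality give |p 0| - |p z| ≤ |z| (|p z| + |p 0|), which
is then solved for |p z|. -/
lemma norm_ge_of_re_pos {p : ℂ → ℂ} (hp : DifferentiableOn ℂ p unitDisc)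
    (hre : ∀ z ∈ unitDisc, 0 < (p z).re) {z : ℂ} (hz : z ∈ unitDisc) :
    ‖p 0‖ * ((1 - ‖z‖) / (1 + ‖z‖)) ≤ ‖p z‖ := by
  have h := (norm_cayley_le hp hre).1 z hz
  have h1 := norm_sub_norm_le (p 0) (p z)
  have h2 := norm_add_le (p z) ((starRingEnd ℂ) (p 0))
  rw [norm_conj] at h2
  rw [norm_sub_rev] at h1
  rw [mul_div_assoc', div_le_iff₀ (by positivity)]
  nlinarith [norm_nonneg z]

/-! ### Holomorphic inverses of univalent functions. -/

section Inverse

variable {U : Set ℂ} {h : ℂ → ℂ}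

/-- Open mapping dichotomy: injectivity excludes local constancy. -/
lemma nhds_le_map_of_injOn (hU : IsOpen U) (hd : DifferentiableOn ℂ h U) (hi : InjOn h U) {c : ℂ}
    (hc : c ∈ U) : 𝓝 (h c) ≤ map h (𝓝 c) := by
  refine (hd.analyticAt (hU.mem_nhds hc)).eventually_constant_or_nhds_le_map_nhds.resolve_left ?_
  intro hev
  have h1 : ∀ᶠ z in 𝓝[≠] c, h z = h c ∧ z ∈ U := (hev.and (hU.mem_nhds hc)).filter_mono inf_le_left
  obtain ⟨z, ⟨hz, hzU⟩, hne⟩ := (h1.and self_mem_nhdsWithin).exists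
  exact hne (hi hzU hc hz)

/-- A univalent function has non-vanishing derivative and a holomorphic inverse. -/
lemma deriv_ne_zero_and_hasDerivAt_invFunOn (hU : IsOpen U) (hd : DifferentiableOn ℂ h U)
    (hi : InjOn h U) {c : ℂ} (hc : c ∈ U) :
    deriv h c ≠ 0 ∧ HasDerivAt (Function.invFunOn h U) (deriv h c)⁻¹ (h c) := by
  set H := Function.invFunOn h U
  have hleft : ∀ z ∈ U, H (h z) = z := fun z hz => hi.leftInvOn_invFunOn hz
  have hcont : ∀ c ∈ U, ContinuousAt H (h c) := by
    intro c hc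
    rw [ContinuousAt, hleft c hc]
    intro V hV
    have h1 : h '' (V ∩ U) ∈ 𝓝 (h c) :=
      nhds_le_map_of_injOn hU hd hi hc (image_mem_map (inter_mem hV (hU.mem_nhds hc)))
    refine mem_map.2 (mem_of_superset h1 ?_)
    rintro _ ⟨z, ⟨hzV, hzU⟩, rfl⟩
    simpa [hleft z hzU] using hzV
  have hright : ∀ c ∈ U, ∀ᶠ y in 𝓝 (h c), h (H y) = y ∧ H y ∈ U := by
    intro c hc
    have h1 : h '' U ∈ 𝓝 (h c) :=
      nhds_le_map_of_injOn hU hd hi hc (image_mem_map (hU.mem_nhds hc))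
    filter_upwards [h1]
    rintro _ ⟨z, hz, rfl⟩
    rw [hleft z hz]; exact ⟨rfl, hz⟩
  have hderiv : ∀ c ∈ U, HasDerivAt h (deriv h c) c := fun c hc =>
    (hd.differentiableAt (hU.mem_nhds hc)).hasDerivAt
  have hinv : ∀ c ∈ U, deriv h c ≠ 0 → HasDerivAt H (deriv h c)⁻¹ (h c) := by
    intro c hc h0
    refine HasDerivAt.of_local_left_inverse (hcont c hc) ?_ h0 ((hright c hc).mono fun _ h => h.1)
    rw [hleft c hc]; exact hderiv c hc
  suffices h0 : deriv h c ≠ 0 from ⟨h0, hinv c hc h0⟩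
  have han : AnalyticAt ℂ h c := hd.analyticAt (hU.mem_nhds hc)
  have hpunct : ∀ᶠ z in 𝓝[≠] c, deriv h z ≠ 0 := by
    refine han.deriv.eventually_eq_zero_or_eventually_ne_zero.resolve_left fun hev => ?_
    obtain ⟨ε, hε, hb⟩ := Metric.eventually_nhds_iff_ball.1 (hev.and (hU.mem_nhds hc))
    obtain ⟨z, hz, hzc⟩ : ∃ z ∈ ball c ε, z ≠ c := by
      refine ⟨c + (ε / 2 : ℝ), ?_, ?_⟩
      · rw [mem_ball, dist_self_add_left, norm_real, Real.norm_of_nonneg (by positivity)]; linarith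
      · simp [hε.ne']
    have := (convex_ball c ε).is_const_of_fderivWithin_eq_zero (𝕜 := ℂ) (f := h)
      (hd.mono fun x hx => (hb x hx).2) (fun x hx => by
        rw [fderivWithin_of_isOpen isOpen_ball hx]
        ext; simp [(hb x hx).1]) hz (mem_ball_self hε)
    exact hzc (hi (hb z hz).2 hc this)
  -- Zeros of h' are isolated, so H is holomorphic near h c except perhaps at h c, where it is
  -- continuous. The singularity is removable, and the chain rule for H ∘ h = id then rules out h' c
  -- = 0.
  have hH : AnalyticAt ℂ H (h c) := by
    refine analyticAt_of_differentiable_on_punctured_nhds_of_continuousAt ?_ (hcont c hc)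
    have ht : Tendsto H (𝓝 (h c)) (𝓝 c) := by simpa [ContinuousAt, hleft c hc] using hcont c hc
    rw [eventually_nhdsWithin_iff] at hpunct ⊢
    filter_upwards [ht.eventually hpunct, hright c hc] with y hy1 hy2 hne
    have hne' : H y ≠ c := fun he => hne (by rw [← hy2.1, he]; rfl)
    have := hinv (H y) hy2.2 (hy1 hne')
    rw [hy2.1] at this
    exact this.differentiableAt
  have hcomp : HasDerivAt (fun z => H (h z)) (deriv H (h c) * deriv h c) c :=
    HasDerivAt.comp c hH.differentiableAt.hasDerivAt (hderiv c hc)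
  have hid : HasDerivAt (fun z => H (h z)) 1 c :=
    (hasDerivAt_id c).congr_of_eventuallyEq ((hU.eventually_mem hc).mono hleft)
  intro h0
  have := hcomp.unique hid
  simp [h0] at this

lemma isOpen_image_of_injOn (hU : IsOpen U) (hd : DifferentiableOn ℂ h U) (hi : InjOn h U) :
    IsOpen (h '' U) := by
  rw [isOpen_iff_mem_nhds]
  rintro _ ⟨c, hc, rfl⟩
  exact nhds_le_map_of_injOn hU hd hi hc (image_mem_map (hU.mem_nhds hc))

lemma differentiableOn_invFunOn (hU : IsOpen U) (hd : DifferentiableOn ℂ h U) (hi : InjOn h U) :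
    DifferentiableOn ℂ (Function.invFunOn h U) (h '' U) := by
  rintro _ ⟨c, hc, rfl⟩
  exact (deriv_ne_zero_and_hasDerivAt_invFunOn hU hd hi hc).2.differentiableAt
    |>.differentiableWithinAt

end Inverse

/-! ### Convex univalent functions: coefficients, starlikeness of order 1/2, growth. -/

/-- A univalent function of the unit disc with convex image which vanishes at the origin. -/
structure IsConvexUnivalent (h : ℂ → ℂ) : Prop where
  diff : DifferentiableOn ℂ h unitDisc
  inj : InjOn h unitDisc
  conv : Convex ℝ (h '' unitDisc)
  zero : h 0 = 0

namespace IsConvexUnivalent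

variable {h : ℂ → ℂ}

lemma hasDerivAt (hh : IsConvexUnivalent h) {z : ℂ} (hz : z ∈ unitDisc) :
    HasDerivAt h (deriv h z) z :=
  (hh.diff.differentiableAt (isOpen_unitDisc.mem_nhds hz)).hasDerivAt

lemma deriv_ne_zero (hh : IsConvexUnivalent h) {z : ℂ} (hz : z ∈ unitDisc) : deriv h z ≠ 0 :=
  (deriv_ne_zero_and_hasDerivAt_invFunOn isOpen_unitDisc hh.diff hh.inj hz).1

lemma ne_zero (hh : IsConvexUnivalent h) {z : ℂ} (hz : z ∈ unitDisc) (h0 : z ≠ 0) : h z ≠ 0 :=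
  fun he => h0 (hh.inj hz zero_mem_unitDisc (he.trans hh.zero.symm))

/-- Functions with values in the image of `h` lift through `h` to self-maps of the disc. -/
lemma exists_lift (hh : IsConvexUnivalent h) {u : ℂ → ℂ} (hu : DifferentiableOn ℂ u unitDisc)
    (hm : MapsTo u unitDisc (h '' unitDisc)) (h0 : u 0 = 0) :
    ∃ φ : ℂ → ℂ, (∀ z, φ z = Function.invFunOn h unitDisc (u z)) ∧
      DifferentiableOn ℂ φ unitDisc ∧ MapsTo φ unitDisc unitDisc ∧ φ 0 = 0 ∧
      ∀ z ∈ unitDisc, h (φ z) = u z := by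
  refine ⟨fun z => Function.invFunOn h unitDisc (u z), fun _ => rfl, ?_, ?_, ?_, ?_⟩
  · exact (differentiableOn_invFunOn isOpen_unitDisc hh.diff hh.inj).comp hu hm
  · exact fun z hz => Function.invFunOn_mem (hm hz)
  · change Function.invFunOn h unitDisc (u 0) = 0
    rw [h0]
    simpa only [hh.zero] using hh.inj.leftInvOn_invFunOn zero_mem_unitDisc
  · exact fun z hz => Function.invFunOn_eq (hm hz)

/-- The coefficients of a convex univalent function are bounded by the first one. -/
lemma norm_taylorCoeff_le (hh : IsConvexUnivalent h) {n : ℕ} (hn : n ≠ 0) :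
    ‖taylorCoeff h n‖ ≤ ‖deriv h 0‖ := by
  -- The average stays in the convex image, so it is subordinate to h: U = h ∘ φ with φ 0 = 0, and
  -- Schwarz gives |φ' 0| ≤ 1.
  obtain ⟨U, hU, hU0, hU1, hC⟩ := exists_rotation_average hh.diff hn
  have hm := hC _ hh.conv (mapsTo_image h unitDisc)
  obtain ⟨φ, -, hφ, hφm, hφ0, hφh⟩ := hh.exists_lift hU hm (hU0.trans hh.zero)
  have h1 : ‖deriv φ 0‖ ≤ 1 := norm_deriv_le_one_of_mapsTo_ball (R := 1) hφ
    (by rw [hφ0]; exact hφm.mono_right ball_subset_closedBall) one_pos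
  have hdφ : HasDerivAt φ (deriv φ 0) 0 :=
    (hφ.differentiableAt (isOpen_unitDisc.mem_nhds zero_mem_unitDisc)).hasDerivAt
  have hdh : HasDerivAt h (deriv h 0) (φ 0) := by
    rw [hφ0]; exact hh.hasDerivAt zero_mem_unitDisc
  have hd : HasDerivAt (fun z => h (φ z)) (deriv h 0 * deriv φ 0) 0 := HasDerivAt.comp 0 hdh hdφ
  have hd2 : HasDerivAt U (deriv h 0 * deriv φ 0) 0 := hd.congr_of_eventuallyEq
    ((isOpen_unitDisc.eventually_mem zero_mem_unitDisc).mono fun z hz => (hφh z hz).symm)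
  rw [← hU1, hd2.deriv, norm_mul]
  exact mul_le_of_le_one_right (norm_nonneg _) h1

/-- The image of a closed concentric disc lies on one side of its tangent at each boundary
point. -/
lemma re_sub_div_nonneg (hh : IsConvexUnivalent h) {z ζ : ℂ} (hz : z ∈ unitDisc) (hz0 : z ≠ 0)
    (hζ : ‖ζ‖ ≤ ‖z‖) : 0 ≤ ((h z - h ζ) / (z * deriv h z)).re := by
  set κ := ζ / z with hκ
  have hκ1 : ‖κ‖ ≤ 1 := by
    rw [hκ, norm_div]; exact div_le_one_of_le₀ hζ (norm_nonneg _)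
  have hκz : κ * z = ζ := div_mul_cancel₀ _ hz0
  have hmem : ∀ x ∈ unitDisc, κ * x ∈ unitDisc := by
    intro x hx
    rw [mem_unitDisc] at hx ⊢
    rw [norm_mul]
    exact (mul_le_of_le_one_left (norm_nonneg _) hκ1).trans_lt hx
  set H := Function.invFunOn h unitDisc
  set γ : ℝ → ℂ := fun t => H (h z + t * (h ζ - h z)) with hγ
  have hγ0 : γ 0 = z := by
    simp only [hγ, ofReal_zero, zero_mul, add_zero]
    exact hh.inj.leftInvOn_invFunOn hz
  -- γ pulls back the segment from h z to h ζ. For fixed t, x ↦ (1 - t) h x + t h (κ x) lifts to a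
  -- self-map of the disc fixing 0; Schwarz at x = z keeps γ t in the disc of radius |z|. Hence |γ|²
  -- cannot increase to first order at t = 0.
  have hbound : ∀ t ∈ Icc (0 : ℝ) 1, ‖γ t‖ ≤ ‖z‖ := by
    intro t ht
    have hu : DifferentiableOn ℂ (fun x => h x + t * (h (κ * x) - h x)) unitDisc := by
      have h1 : DifferentiableOn ℂ (fun x => h (κ * x)) unitDisc :=
        hh.diff.comp (by fun_prop) hmem
      exact hh.diff.add ((h1.sub hh.diff).const_mul _)
    obtain ⟨φ, hφe, hφ, hφm, hφ0, -⟩ := hh.exists_lift hu (by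
      intro x hx
      have := hh.conv (mem_image_of_mem h hx) (mem_image_of_mem h (hmem x hx))
        (sub_nonneg.2 ht.2) ht.1 (by ring)
      convert this using 1
      simp only [real_smul, ofReal_sub, ofReal_one]
      ring) (by simp [hh.zero])
    have := norm_le_norm_of_mapsTo_ball hφ (hφm.mono_right ball_subset_closedBall) hφ0
      (mem_unitDisc.1 hz)
    rw [hφe] at this
    simpa only [hκz] using this
  have hd : HasDerivAt γ ((deriv h z)⁻¹ * (h ζ - h z)) 0 := by
    have h1 := (deriv_ne_zero_and_hasDerivAt_invFunOn isOpen_unitDisc hh.diff hh.inj hz).2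
    have h2 : HasDerivAt (fun t : ℝ => h z + t * (h ζ - h z)) (h ζ - h z) 0 := by
      simpa using ((ofRealCLM.hasDerivAt (x := (0 : ℝ))).mul_const (h ζ - h z)).const_add (h z)
    have h3 : HasDerivAt H (deriv h z)⁻¹ (h z + ((0 : ℝ) : ℂ) * (h ζ - h z)) := by simpa using h1
    exact HasDerivAt.comp (0 : ℝ) h3 h2
  set v := (deriv h z)⁻¹ * (h ζ - h z) with hv
  have hsq : HasDerivAt (fun t => ‖γ t‖ ^ 2) (2 * inner ℝ z v) 0 := by
    simpa [hγ0] using hd.norm_sq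
  have hle : 2 * inner ℝ z v ≤ 0 := by
    have hmax : ∀ᶠ t in 𝓝[>] (0 : ℝ), slope (fun t => ‖γ t‖ ^ 2) 0 t ≤ 0 := by
      filter_upwards [Ioc_mem_nhdsGT (zero_lt_one' ℝ)] with t ht
      rw [slope_def_field]
      refine div_nonpos_of_nonpos_of_nonneg ?_ (by simpa using ht.1.le)
      rw [hγ0, sub_nonpos]
      exact pow_le_pow_left₀ (norm_nonneg _) (hbound t ⟨ht.1.le, ht.2⟩) 2
    have hlim : Tendsto (slope (fun t => ‖γ t‖ ^ 2) 0) (𝓝[>] 0) (𝓝 (2 * inner ℝ z v)) :=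
      (hasDerivAt_iff_tendsto_slope.1 hsq).mono_left (nhdsWithin_mono _ fun x hx => ne_of_gt hx)
    exact le_of_tendsto hlim hmax
  have hinner : inner ℝ z v = -(normSq z * ((h z - h ζ) / (z * deriv h z)).re) := by
    have : v * (starRingEnd ℂ) z = -((normSq z : ℝ) * ((h z - h ζ) / (z * deriv h z))) := by
      rw [← mul_conj, hv]
      have := hh.deriv_ne_zero hz
      field_simp
      ring
    rw [Complex.inner, this, neg_re, re_ofReal_mul]
  have hpos : 0 < normSq z := normSq_pos.2 hz0
  rw [hinner] at hle
  by_contra hneg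
  push Not at hneg
  nlinarith [mul_pos_of_neg_of_neg (neg_lt_zero.2 hpos) hneg]

/-- Convex univalent functions are starlike of order one half. -/
lemma half_le_re (hh : IsConvexUnivalent h) {z : ℂ} (hz : z ∈ unitDisc) (hz0 : z ≠ 0) :
    1 / 2 ≤ (z * deriv h z / h z).re := by
  have hh' := hh.deriv_ne_zero hz
  have hc0 : z * deriv h z ≠ 0 := mul_ne_zero hz0 hh'
  set V : Set ℂ := {ζ | z * ζ ∈ unitDisc} with hV
  have hVo : IsOpen V := isOpen_unitDisc.preimage (by fun_prop)
  have hVb : closedBall (0 : ℂ) 1 ⊆ V := by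
    intro ζ hζ
    rw [mem_closedBall_zero_iff] at hζ
    change z * ζ ∈ unitDisc
    rw [mem_unitDisc] at hz ⊢
    rw [norm_mul]
    exact (mul_le_of_le_one_right (norm_nonneg _) hζ).trans_lt hz
  have h1V : (1 : ℂ) ∈ V := hVb (by simp)
  have hVn : V ∈ 𝓝 (1 : ℂ) := hVo.mem_nhds h1V
  -- Re k ≥ 0 on the unit circle by `re_sub_div_nonneg`, and 1 / k 0 = z h'(z) / h(z). The plan is
  -- to subtract (1 + ζ) / (2 (1 - ζ)) from 1 / k, which cancels the pole at 1 and is purely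
  -- imaginary on the rest of the circle.
  set k : ℂ → ℂ := fun ζ => (h z - h (z * ζ)) / (z * deriv h z) with hk
  have hkd : DifferentiableOn ℂ k V := by
    have h1 : DifferentiableOn ℂ (fun ζ => h (z * ζ)) V :=
      hh.diff.comp (by fun_prop) fun ζ hζ => hζ
    exact ((differentiableOn_const _).sub h1).div_const _
  have hk1 : k 1 = 0 := by simp [hk]
  have hk0 : ∀ ζ ∈ V, k ζ = 0 → ζ = 1 := by
    intro ζ hζ he
    rw [hk, div_eq_zero_iff, or_iff_left hc0, sub_eq_zero] at he
    have := hh.inj hz hζ he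
    exact (mul_left_cancel₀ hz0 (by rw [mul_one]; exact this)).symm
  have hkd1 : deriv k 1 = -1 := by
    have h1 : HasDerivAt (fun ζ => h (z * ζ)) (deriv h z * z) 1 := by
      have h2 : HasDerivAt (fun ζ => z * ζ) z 1 := by
        simpa using (hasDerivAt_id (1 : ℂ)).const_mul z
      have h3 : HasDerivAt h (deriv h z) (z * 1) := by rw [mul_one]; exact hh.hasDerivAt hz
      exact HasDerivAt.comp 1 h3 h2
    have h4 := ((h1.const_sub (h z)).div_const (z * deriv h z)).deriv
    rw [h4]
    field_simp
  set m : ℂ → ℂ := fun ζ => -dslope k 1 ζ with hm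
  have hmk : ∀ ζ, ζ ≠ 1 → m ζ = k ζ / (1 - ζ) := by
    intro ζ hζ
    rw [hm]
    simp only
    rw [dslope_of_ne _ hζ, slope_def_field, hk1, sub_zero, ← div_neg, neg_sub]
  have hm1 : m 1 = 1 := by simp [hm, hkd1]
  have hmd : DifferentiableOn ℂ m V := ((differentiableOn_dslope hVn).2 hkd).neg
  have hm0 : ∀ ζ ∈ V, m ζ ≠ 0 := by
    intro ζ hζ
    by_cases h1 : ζ = 1
    · rw [h1, hm1]; exact one_ne_zero
    · rw [hmk ζ h1]
      exact div_ne_zero (fun he => h1 (hk0 ζ hζ he)) (sub_ne_zero.2 (Ne.symm h1))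
  -- Here m is k / (1 - ζ) with the singularity at 1 removed. Since N vanishes at 1, dividing by 1 -
  -- ζ again leaves F holomorphic on a neighbourhood of the closed disc.
  set N : ℂ → ℂ := fun ζ => (m ζ)⁻¹ - (1 + ζ) / 2 with hN
  have hN1 : N 1 = 0 := by simp only [hN, hm1]; norm_num
  have hNd : DifferentiableOn ℂ N V := (hmd.inv hm0).sub (by fun_prop)
  set F : ℂ → ℂ := fun ζ => -dslope N 1 ζ with hF
  have hFd : DifferentiableOn ℂ F V := ((differentiableOn_dslope hVn).2 hNd).neg
  have hFk : ∀ ζ ∈ V, ζ ≠ 1 → F ζ = (k ζ)⁻¹ - (1 + ζ) / (1 - ζ) / 2 := by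
    intro ζ hζV hζ
    have h1 : 1 - ζ ≠ 0 := sub_ne_zero.2 hζ.symm
    have h2 : k ζ ≠ 0 := fun he => hζ (hk0 ζ hζV he)
    simp only [hF]
    rw [dslope_of_ne _ hζ, slope_def_field, hN1, sub_zero, ← div_neg, neg_sub, hN]
    simp only
    rw [hmk ζ hζ]
    field_simp
  have hFre : ∀ ζ : ℂ, ‖ζ‖ = 1 → ζ ≠ 1 → 0 ≤ (F ζ).re := by
    intro ζ hζ hne
    have hζV : ζ ∈ V := hVb (by simp [hζ])
    rw [hFk ζ hζV hne, sub_re]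
    have h1 : 0 ≤ ((k ζ)⁻¹).re := by
      rw [inv_re]
      refine div_nonneg ?_ (normSq_nonneg _)
      exact hh.re_sub_div_nonneg hz hz0 (by rw [norm_mul, hζ, mul_one])
    have h2 : ((1 + ζ) / (1 - ζ) / 2).re = 0 := by
      have h3 : ((1 + ζ) / (1 - ζ)).re = 0 := by
        rw [div_re, ← add_div]
        have h4 : normSq ζ = 1 := by rw [normSq_eq_norm_sq, hζ]; norm_num
        rw [normSq_apply] at h4
        have h5 : (1 + ζ).re * (1 - ζ).re + (1 + ζ).im * (1 - ζ).im = 0 := by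
          simp only [add_re, sub_re, add_im, sub_im, one_re, one_im]
          linarith
        rw [h5, zero_div]
      have h6 : (1 + ζ) / (1 - ζ) / 2 = ((1 / 2 : ℝ) : ℂ) * ((1 + ζ) / (1 - ζ)) := by
        push_cast; ring
      rw [h6, re_ofReal_mul, h3, mul_zero]
    linarith
  have hF1 : 0 ≤ (F 1).re := by
    have hc : ContinuousAt F 1 := (hFd.differentiableAt hVn).continuousAt
    have he : Tendsto (fun t : ℝ => exp (t * I)) (𝓝[>] 0) (𝓝 1) := by
      have : Continuous fun t : ℝ => exp (t * I) := by fun_prop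
      simpa using (this.tendsto 0).mono_left (nhdsWithin_le_nhds (s := Ioi (0 : ℝ)))
    have ht : Tendsto (fun t : ℝ => (F (exp (t * I))).re) (𝓝[>] 0) (𝓝 (F 1).re) :=
      (continuous_re.tendsto _).comp (hc.tendsto.comp he)
    refine ge_of_tendsto ht ?_
    filter_upwards [Ioo_mem_nhdsGT Real.pi_pos] with t ht
    refine hFre _ (norm_exp_ofReal_mul_I t) fun h1 => ?_
    have h2 := congrArg im h1
    rw [exp_ofReal_mul_I_im, one_im] at h2
    exact (Real.sin_pos_of_pos_of_lt_pi ht.1 ht.2).ne' h2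
  -- The maximum principle for exp(-F) carries Re F ≥ 0 from the circle to the origin, where the
  -- subtracted term equals 1/2.
  have hmax : ‖exp (-F 0)‖ ≤ 1 := by
    refine norm_le_of_forall_mem_frontier_norm_le (f := fun ζ => exp (-F ζ)) (U := ball 0 1)
      isBounded_ball (hFd.neg.cexp.diffContOnCl_ball hVb) ?_ (subset_closure (by simp))
    rw [frontier_ball _ one_ne_zero]
    intro ζ hζ
    rw [mem_sphere_zero_iff_norm] at hζ
    rw [norm_exp, Real.exp_le_one_iff, neg_re, neg_nonpos]
    by_cases h1 : ζ = 1
    · rwa [h1]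
    · exact hFre ζ hζ h1
  rw [norm_exp, Real.exp_le_one_iff, neg_re, neg_nonpos,
    hFk 0 (hVb (by simp)) zero_ne_one, sub_re] at hmax
  have hk00 : (k 0)⁻¹ = z * deriv h z / h z := by simp [hk, hh.zero]
  rw [hk00] at hmax
  norm_num at hmax ⊢
  linarith

/-- For q = z h'/h, the condition Re q ≥ 1/2 means |1/q - 1| ≤ 1. As 1/q - 1 extends by 0 to the
origin, Schwarz improves the bound to |z|. -/
lemma norm_div_sub_one_le (hh : IsConvexUnivalent h) {z : ℂ} (hz : z ∈ unitDisc) (hz0 : z ≠ 0) :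
    ‖h z / (z * deriv h z) - 1‖ ≤ ‖z‖ := by
  have hD : unitDisc ∈ 𝓝 (0 : ℂ) := isOpen_unitDisc.mem_nhds zero_mem_unitDisc
  have hd : DifferentiableOn ℂ (fun z => dslope h 0 z / deriv h z - 1) unitDisc :=
    (((differentiableOn_dslope hD).2 hh.diff).div (hh.diff.deriv isOpen_unitDisc)
      fun z hz => hh.deriv_ne_zero hz).sub_const _
  have he : ∀ z ≠ 0, dslope h 0 z / deriv h z - 1 = h z / (z * deriv h z) - 1 := by
    intro z hz0
    rw [dslope_of_ne _ hz0, slope_def_field, hh.zero, sub_zero, sub_zero, div_div]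
  have h0 : dslope h 0 0 / deriv h 0 - 1 = 0 := by
    rw [dslope_same, div_self (hh.deriv_ne_zero zero_mem_unitDisc), sub_self]
  rw [← he z hz0]
  refine norm_le_norm_of_mapsTo_ball (f := fun z => dslope h 0 z / deriv h z - 1) hd ?_ h0
    (mem_unitDisc.1 hz)
  intro w hw
  rw [mem_closedBall_zero_iff]
  change ‖dslope h 0 w / deriv h w - 1‖ ≤ 1
  by_cases hw0 : w = 0
  · rw [hw0, h0, norm_zero]; exact zero_le_one
  rw [he w hw0]
  have h1 := hh.half_le_re hw hw0
  set q := w * deriv h w / h w with hq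
  have hq0 : q ≠ 0 := by
    intro h; rw [h] at h1; norm_num at h1
  have h2 : h w / (w * deriv h w) = q⁻¹ := by rw [hq, inv_div]
  have h3 : q⁻¹ - 1 = (1 - q) / q := by field_simp
  rw [h2, h3, norm_div, div_le_one (norm_pos_iff.2 hq0),
    ← sq_le_sq₀ (norm_nonneg _) (norm_nonneg _), ← normSq_eq_norm_sq, ← normSq_eq_norm_sq]
  simp only [normSq_apply, sub_re, sub_im, one_re, one_im]
  nlinarith

/-- Convex univalent functions are starlike. -/
lemma re_pos (hh : IsConvexUnivalent h) {z : ℂ} (hz : z ∈ unitDisc) (hz0 : z ≠ 0) :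
    0 < (z * deriv h z / h z).re := by
  linarith [hh.half_le_re hz hz0]

/-- The second part is |1 + ā w|² - |w + a|² = (1 - |a|²)(1 - |w|²). -/
lemma moebius_facts {a : ℂ} (ha : a ∈ unitDisc) :
    (∀ w ∈ unitDisc, 1 + (starRingEnd ℂ) a * w ≠ 0) ∧
    (∀ w ∈ unitDisc, (w + a) / (1 + (starRingEnd ℂ) a * w) ∈ unitDisc) := by
  have hne : ∀ w ∈ unitDisc, 1 + (starRingEnd ℂ) a * w ≠ 0 := by
    intro w hw h
    rw [mem_unitDisc] at ha hw
    have h1 : (starRingEnd ℂ) a * w = -1 := by linear_combination h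
    have h2 := congrArg norm h1
    rw [norm_mul, norm_conj, norm_neg, norm_one] at h2
    nlinarith [norm_nonneg a, norm_nonneg w]
  refine ⟨hne, fun w hw => ?_⟩
  have h1 := hne w hw
  rw [mem_unitDisc] at ha hw ⊢
  rw [norm_div, div_lt_one (norm_pos_iff.2 h1), ← sq_lt_sq₀ (norm_nonneg _) (norm_nonneg _),
    ← normSq_eq_norm_sq, ← normSq_eq_norm_sq]
  have ha2 : normSq a < 1 := by
    rw [normSq_eq_norm_sq]; exact pow_lt_one₀ (norm_nonneg _) ha two_ne_zero
  have hw2 : normSq w < 1 := by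
    rw [normSq_eq_norm_sq]; exact pow_lt_one₀ (norm_nonneg _) hw two_ne_zero
  have := mul_pos (sub_pos.2 ha2) (sub_pos.2 hw2)
  simp only [normSq_apply, add_re, add_im, mul_re, mul_im, conj_re, conj_im, one_re,
    one_im] at this ⊢
  linarith

/-- The Koebe transform of a convex univalent function is convex univalent. -/
lemma koebe (hh : IsConvexUnivalent h) {a : ℂ} (ha : a ∈ unitDisc) :
    IsConvexUnivalent fun w => h ((w + a) / (1 + (starRingEnd ℂ) a * w)) - h a := by
  obtain ⟨hne, hm⟩ := moebius_facts ha
  have ha' : -a ∈ unitDisc := by simpa [unitDisc] using ha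
  obtain ⟨hne', hm'⟩ := moebius_facts ha'
  have hinv : ∀ w ∈ unitDisc, ((w - a) / (1 - (starRingEnd ℂ) a * w) + a) /
      (1 + (starRingEnd ℂ) a * ((w - a) / (1 - (starRingEnd ℂ) a * w))) = w := by
    intro w hw
    have h1 : 1 - (starRingEnd ℂ) a * w ≠ 0 := by
      have := hne' w hw; rw [map_neg] at this; intro h; exact this (by linear_combination h)
    have h3 : (w - a) / (1 - (starRingEnd ℂ) a * w) ∈ unitDisc := by
      have := hm' w hw
      rwa [map_neg, neg_mul, ← sub_eq_add_neg, ← sub_eq_add_neg] at this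
    have h2 := hne _ h3
    rw [div_eq_iff h2]
    generalize hd : 1 - (starRingEnd ℂ) a * w = d at h1 ⊢
    field_simp
    rw [← hd]
    ring
  refine ⟨?_, ?_, ?_, ?_⟩
  · refine (hh.diff.comp (t := unitDisc) ?_ hm).sub_const _
    exact DifferentiableOn.div (by fun_prop) (by fun_prop) hne
  · intro x hx y hy hxy
    have h1 := hh.inj (hm x hx) (hm y hy) (sub_left_inj.1 hxy)
    rw [div_eq_div_iff (hne x hx) (hne y hy)] at h1
    have h2 : (x - y) * (1 - (starRingEnd ℂ) a * a) = 0 := by linear_combination h1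
    have h3 : 1 - (starRingEnd ℂ) a * a ≠ 0 := by
      have := hne (-a) ha'; intro h; exact this (by linear_combination h)
    exact sub_eq_zero.1 ((mul_eq_zero.1 h2).resolve_right h3)
  · have himg : (fun w => h ((w + a) / (1 + (starRingEnd ℂ) a * w)) - h a) '' unitDisc =
        (fun x => -h a + x) '' (h '' unitDisc) := by
      ext y
      constructor
      · rintro ⟨w, hw, rfl⟩
        exact ⟨_, mem_image_of_mem h (hm w hw), by ring⟩
      · rintro ⟨_, ⟨w, hw, rfl⟩, rfl⟩
        refine ⟨(w - a) / (1 - (starRingEnd ℂ) a * w), ?_, ?_⟩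
        · have := hm' w hw
          rwa [map_neg, neg_mul, ← sub_eq_add_neg, ← sub_eq_add_neg] at this
        · simp only [hinv w hw]; ring
    rw [himg]
    exact hh.conv.translate _
  · simp

/-- The growth theorem for convex univalent functions, lower bound. -/
lemma le_norm (hh : IsConvexUnivalent h) {a : ℂ} (ha : a ∈ unitDisc) :
    ‖deriv h 0‖ * (‖a‖ / (1 + ‖a‖)) ≤ ‖h a‖ := by
  by_cases ha0 : a = 0
  · simp [ha0]
  have ha' : -a ∈ unitDisc := by simpa [unitDisc] using ha
  have hna := mem_unitDisc.1 ha
  have hnorm : 1 + (starRingEnd ℂ) a * -a = ((1 - ‖a‖ ^ 2 : ℝ) : ℂ) := by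
    rw [mul_neg, mul_comm, mul_conj, normSq_eq_norm_sq]; push_cast; ring
  have hpos : 0 < 1 - ‖a‖ ^ 2 := by nlinarith [norm_nonneg a]
  have hne : 1 + (starRingEnd ℂ) a * -a ≠ 0 := (moebius_facts ha).1 _ ha'
  -- At -a the Koebe transform has value -h a and derivative h' 0 / (1 - |a|²), so this estimate
  -- links h a directly to h' 0.
  have h1 := (hh.koebe ha).norm_div_sub_one_le ha' (neg_ne_zero.2 ha0)
  have hd : HasDerivAt (fun w => h ((w + a) / (1 + (starRingEnd ℂ) a * w)) - h a)
      (deriv h 0 * (1 + (starRingEnd ℂ) a * -a)⁻¹) (-a) := by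
    have h2 : HasDerivAt (fun w => (w + a) / (1 + (starRingEnd ℂ) a * w))
        (1 + (starRingEnd ℂ) a * -a)⁻¹ (-a) := by
      have h3 : HasDerivAt (fun w => w + a) 1 (-a) := (hasDerivAt_id _).add_const _
      have h4 : HasDerivAt (fun w => 1 + (starRingEnd ℂ) a * w) ((starRingEnd ℂ) a) (-a) := by
        simpa using ((hasDerivAt_id (-a)).const_mul ((starRingEnd ℂ) a)).const_add 1
      refine (h3.fun_div h4 hne).congr_deriv ?_
      rw [neg_add_cancel, zero_mul, sub_zero, one_mul, sq, ← div_div, div_self hne, one_div]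
    have h5 : HasDerivAt h (deriv h 0) ((-a + a) / (1 + (starRingEnd ℂ) a * -a)) := by
      rw [neg_add_cancel, zero_div]; exact hh.hasDerivAt zero_mem_unitDisc
    exact (HasDerivAt.comp (-a) h5 h2).sub_const _
  rw [hd.deriv, neg_add_cancel, zero_div, hh.zero, zero_sub, norm_neg] at h1
  have hb := hh.deriv_ne_zero zero_mem_unitDisc
  have h6 : -h a / (-a * (deriv h 0 * (1 + (starRingEnd ℂ) a * -a)⁻¹)) =
      h a * ((1 - ‖a‖ ^ 2 : ℝ) : ℂ) / (a * deriv h 0) := by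
    rw [← hnorm]; field_simp
  have h7 := norm_sub_norm_le (1 : ℂ) (h a * ((1 - ‖a‖ ^ 2 : ℝ) : ℂ) / (a * deriv h 0))
  rw [h6] at h1
  rw [norm_sub_rev, norm_one, norm_div, norm_mul, norm_mul, norm_real,
    Real.norm_of_nonneg hpos.le] at h7
  have hap : 0 < ‖a‖ := norm_pos_iff.2 ha0
  have hbp : 0 < ‖deriv h 0‖ := norm_pos_iff.2 hb
  have h8 : 1 - ‖a‖ ≤ ‖h a‖ * (1 - ‖a‖ ^ 2) / (‖a‖ * ‖deriv h 0‖) := by linarith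
  rw [le_div_iff₀ (by positivity)] at h8
  rw [mul_div_assoc', div_le_iff₀ (by positivity)]
  have h9 : (1 - ‖a‖) * (‖deriv h 0‖ * ‖a‖) ≤ (1 - ‖a‖) * (‖h a‖ * (1 + ‖a‖)) := by
    linarith
  exact le_of_mul_le_mul_left h9 (by linarith)

end IsConvexUnivalent

/-! ### Coefficient and distortion bounds for the class `C₁`. -/

lemma IsConvexFunction.isConvexUnivalent {g : ℂ → ℂ} (hg : IsConvexFunction g) :
    IsConvexUnivalent g := ⟨hg.analytic, hg.univalent, hg.convex_image, hg.map_zero⟩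

lemma IsConvexUnivalent.dslope_ne_zero {g : ℂ → ℂ} (hg : IsConvexUnivalent g) {z : ℂ}
    (hz : z ∈ unitDisc) : dslope g 0 z ≠ 0 := by
  by_cases hz0 : z = 0
  · rw [hz0, dslope_same]; exact hg.deriv_ne_zero zero_mem_unitDisc
  · rw [dslope_of_ne _ hz0, slope_def_field, hg.zero, sub_zero, sub_zero]
    exact div_ne_zero (hg.ne_zero hz hz0) hz0

/-- Using `dslope g 0` for g(z)/z absorbs the removable singularity; at 0, p equals 1/b₁, so Re b₁ >
0 gives its positivity there. -/
lemma IsClassC1.exists_factorization {f : ℂ → ℂ} (hf : IsClassC1 f) :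
    ∃ g p : ℂ → ℂ, IsConvexUnivalent g ∧ 0 < (deriv g 0).re ∧
      (∀ z ∈ unitDisc, z ≠ 0 → 0 < (z * deriv f z / g z).re) ∧
      DifferentiableOn ℂ p unitDisc ∧ (∀ z ∈ unitDisc, 0 < (p z).re) ∧
      deriv g 0 * p 0 = 1 ∧ ∀ z ∈ unitDisc, deriv f z = dslope g 0 z * p z := by
  obtain ⟨g, hg, hpos⟩ := hf.exists_convex
  have hgc := hg.isConvexUnivalent
  have hD : unitDisc ∈ 𝓝 (0 : ℂ) := isOpen_unitDisc.mem_nhds zero_mem_unitDisc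
  have hne : deriv g 0 ≠ 0 := hgc.deriv_ne_zero zero_mem_unitDisc
  refine ⟨g, fun z => deriv f z / dslope g 0 z, hgc, hg.re_deriv_zero_pos, hpos, ?_, ?_, ?_, ?_⟩
  · exact (hf.analytic.deriv isOpen_unitDisc).div ((differentiableOn_dslope hD).2 hgc.diff)
      fun z hz => hgc.dslope_ne_zero hz
  · intro z hz
    change 0 < (deriv f z / dslope g 0 z).re
    by_cases hz0 : z = 0
    · rw [hz0, hf.deriv_zero, dslope_same, one_div, inv_re]
      exact div_pos hg.re_deriv_zero_pos (normSq_pos.2 hne)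
    · have := hpos z hz hz0
      rw [dslope_of_ne _ hz0, slope_def_field, hgc.zero, sub_zero, sub_zero]
      convert this using 2
      field_simp
  · simp only [hf.deriv_zero, dslope_same]
    field_simp
  · intro z hz
    have := hgc.dslope_ne_zero hz
    field_simp

lemma taylorCoeff_dslope {g : ℂ → ℂ} (hg : DifferentiableOn ℂ g unitDisc) (h0 : g 0 = 0) (n : ℕ) :
    taylorCoeff (dslope g 0) n = taylorCoeff g (n + 1) := by
  refine taylorCoeff_eq_of_hasSum (c := fun n => taylorCoeff g (n + 1)) ?_ n
  intro z hz
  by_cases hz0 : z = 0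
  · subst hz0
    rw [dslope_same, ← taylorCoeff_one]
    convert hasSum_single 0 (f := fun n => taylorCoeff g (n + 1) * (0 : ℂ) ^ n) ?_ using 1
    · simp
    · intro n hn; simp [hn]
  · have h1 := (hasSum_nat_add_iff' 1).2 (hasSum_taylorCoeff hg hz)
    have h2 := h1.div_const z
    simp only [Finset.range_one, Finset.sum_singleton, taylorCoeff_zero, h0, zero_mul,
      sub_zero] at h2
    rw [dslope_of_ne _ hz0, slope_def_field, h0, sub_zero, sub_zero]
    refine h2.congr_fun fun n => ?_
    rw [pow_succ]
    field_simp

lemma taylorCoeff_congr {u v : ℂ → ℂ} (h : ∀ z ∈ unitDisc, u z = v z) (n : ℕ) :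
    taylorCoeff u n = taylorCoeff v n := by
  have he : u =ᶠ[𝓝 0] v := (isOpen_unitDisc.eventually_mem zero_mem_unitDisc).mono h
  rw [taylorCoeff, taylorCoeff, he.iteratedDeriv_eq]

/-- In the coefficient of z ^ m in (g(z)/z) p(z), the m terms involving a nonconstant coefficient of
p are at most 2 |b₁| Re p(0) ≤ 2, and the last is at most |b₁| |p(0)| = 1. Hence (m + 1)|a_{m+1}| ≤
2m + 1. -/
lemma IsClassC1.norm_taylorCoeff_le {f : ℂ → ℂ} (hf : IsClassC1 f) {n : ℕ} (hn : n ≠ 0) :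
    ‖taylorCoeff f n‖ ≤ 2 - 1 / (n : ℝ) := by
  obtain ⟨m, rfl⟩ := Nat.exists_eq_succ_of_ne_zero hn
  obtain ⟨g, p, hg, -, -, hp, hre, h1, hfac⟩ := hf.exists_factorization
  have hD : unitDisc ∈ 𝓝 (0 : ℂ) := isOpen_unitDisc.mem_nhds zero_mem_unitDisc
  have h2 := taylorCoeff_deriv f m
  rw [taylorCoeff_congr hfac m, taylorCoeff_mul ((differentiableOn_dslope hD).2 hg.diff) hp,
    Finset.sum_range_succ, Nat.sub_self, taylorCoeff_zero] at h2
  have h3 := congrArg norm h2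
  set b := ‖deriv g 0‖ with hb
  have hnorm : b * ‖p 0‖ = 1 := by rw [hb, ← norm_mul, h1, norm_one]
  have hre1 : b * (p 0).re ≤ 1 := by
    rw [← hnorm]; exact mul_le_mul_of_nonneg_left (re_le_norm _) (norm_nonneg _)
  have hterm : ∀ k ∈ Finset.range m,
      ‖taylorCoeff (dslope g 0) k * taylorCoeff p (m - k)‖ ≤ 2 := by
    intro k hk
    have hk' : m - k ≠ 0 := by have := Finset.mem_range.1 hk; omega
    rw [norm_mul, taylorCoeff_dslope hg.diff hg.zero]
    have h4 := hg.norm_taylorCoeff_le (Nat.succ_ne_zero k)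
    have h5 := norm_taylorCoeff_le_of_re_pos hp hre hk'
    calc _ ≤ b * (2 * (p 0).re) := mul_le_mul h4 h5 (norm_nonneg _) (norm_nonneg _)
      _ ≤ 2 := by linarith
  have hlast : ‖taylorCoeff (dslope g 0) m * p 0‖ ≤ 1 := by
    rw [norm_mul, taylorCoeff_dslope hg.diff hg.zero, ← hnorm]
    exact mul_le_mul_of_nonneg_right (hg.norm_taylorCoeff_le (Nat.succ_ne_zero m)) (norm_nonneg _)
  have hsum := norm_sum_le_of_le _ hterm
  rw [Finset.sum_const, Finset.card_range, nsmul_eq_mul] at hsum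
  have h6 := norm_add_le (∑ k ∈ Finset.range m,
    taylorCoeff (dslope g 0) k * taylorCoeff p (m - k)) (taylorCoeff (dslope g 0) m * p 0)
  rw [h3, norm_mul] at h6
  have h7 : ‖((m : ℂ) + 1)‖ = m + 1 := by
    have : ((m : ℂ) + 1) = ((m + 1 : ℕ) : ℂ) := by push_cast; rfl
    rw [this, norm_natCast]; push_cast; rfl
  rw [h7] at h6
  have hm : (0 : ℝ) < m + 1 := by positivity
  have h8 : 2 - 1 / ((m.succ : ℕ) : ℝ) = (2 * m + 1) / (m + 1) := by
    push_cast
    field_simp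
    ring
  rw [h8, le_div_iff₀ hm]
  linarith

lemma IsClassC1.le_norm_deriv {f : ℂ → ℂ} (hf : IsClassC1 f) {z : ℂ} (hz : z ∈ unitDisc) :
    (1 - ‖z‖) / (1 + ‖z‖) ^ 2 ≤ ‖deriv f z‖ := by
  obtain ⟨g, p, hg, -, -, hp, hre, h1, hfac⟩ := hf.exists_factorization
  have hz1 := mem_unitDisc.1 hz
  have hA : ‖deriv g 0‖ / (1 + ‖z‖) ≤ ‖dslope g 0 z‖ := by
    by_cases hz0 : z = 0
    · simp [hz0]
    · have h2 := hg.le_norm hz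
      have hzp : 0 < ‖z‖ := norm_pos_iff.2 hz0
      rw [dslope_of_ne _ hz0, slope_def_field, hg.zero, sub_zero, sub_zero, norm_div,
        le_div_iff₀ hzp]
      calc _ = ‖deriv g 0‖ * (‖z‖ / (1 + ‖z‖)) := by ring
        _ ≤ _ := h2
  have hB := norm_ge_of_re_pos hp hre hz
  have hnorm : ‖deriv g 0‖ * ‖p 0‖ = 1 := by rw [← norm_mul, h1, norm_one]
  rw [hfac z hz, norm_mul]
  have hq : 0 ≤ (1 - ‖z‖) / (1 + ‖z‖) := div_nonneg (by linarith) (by positivity)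
  calc (1 - ‖z‖) / (1 + ‖z‖) ^ 2
      = (‖deriv g 0‖ * ‖p 0‖) * ((1 - ‖z‖) / (1 + ‖z‖) ^ 2) := by rw [hnorm, one_mul]
    _ = ‖deriv g 0‖ / (1 + ‖z‖) * (‖p 0‖ * ((1 - ‖z‖) / (1 + ‖z‖))) := by
        field_simp
    _ ≤ _ := mul_le_mul hA hB (mul_nonneg (norm_nonneg _) hq) (norm_nonneg _)

/-! ### Covering a disc of radius 1 - log 2. -/

/-- The lower growth function `2r/(1+r) - log(1+r)`, a primitive of `(1-r)/(1+r)²`. -/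
noncomputable def lowerGrowth (r : ℝ) : ℝ := 2 * r / (1 + r) - Real.log (1 + r)

lemma hasDerivAt_lowerGrowth {r : ℝ} (hr : 0 ≤ r) :
    HasDerivAt lowerGrowth ((1 - r) / (1 + r) ^ 2) r := by
  have h1 : 1 + r ≠ 0 := by positivity
  have h2 : HasDerivAt (fun r : ℝ => 1 + r) 1 r := (hasDerivAt_id r).const_add 1
  have h3 : HasDerivAt (fun r : ℝ => 2 * r) 2 r := by
    simpa using (hasDerivAt_id r).const_mul 2
  refine ((h3.fun_div h2 h1).sub (h2.log h1)).congr_deriv ?_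
  field_simp
  ring

lemma monotoneOn_lowerGrowth : MonotoneOn lowerGrowth (Icc 0 1) := by
  refine monotoneOn_of_deriv_nonneg (convex_Icc 0 1)
    (fun r hr => (hasDerivAt_lowerGrowth hr.1).continuousAt.continuousWithinAt) ?_ ?_
  · intro r hr
    rw [interior_Icc] at hr
    exact (hasDerivAt_lowerGrowth hr.1.le).differentiableAt.differentiableWithinAt
  · intro r hr
    rw [interior_Icc] at hr
    rw [(hasDerivAt_lowerGrowth hr.1.le).deriv]
    exact div_nonneg (by linarith [hr.2]) (by positivity)

/-- A lower bound on the derivative forces the image to cover a disc. -/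
lemma ball_subset_image {f : ℂ → ℂ} (hf : DifferentiableOn ℂ f unitDisc) (h0 : f 0 = 0)
    (hd : ∀ z ∈ unitDisc, (1 - ‖z‖) / (1 + ‖z‖) ^ 2 ≤ ‖deriv f z‖) :
    ball 0 (1 - Real.log 2) ⊆ f '' unitDisc := by
  intro w hw
  rw [mem_ball_zero_iff] at hw
  have hφ1 : lowerGrowth 1 = 1 - Real.log 2 := by norm_num [lowerGrowth]
  have hφ0 : lowerGrowth 0 = 0 := by norm_num [lowerGrowth]
  have hm : 0 < lowerGrowth 1 := by rw [hφ1]; exact (norm_nonneg _).trans_lt hw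
  rw [← hφ1] at hw
  -- The slack c < 1 makes the descent below strict.
  obtain ⟨c, hc1, hcw⟩ : ∃ c < 1, ‖w‖ < c * lowerGrowth 1 := by
    obtain ⟨x, hx1, hx2⟩ := exists_between hw
    exact ⟨x / lowerGrowth 1, (div_lt_one hm).2 hx2, by rwa [div_mul_cancel₀ _ hm.ne']⟩
  have hc0 : 0 < c := by
    by_contra hneg
    push Not at hneg
    nlinarith [norm_nonneg w]
  obtain ⟨R, hR0, hR1, hRw⟩ : ∃ R, 0 < R ∧ R < 1 ∧ ‖w‖ < c * lowerGrowth R := by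
    have hcont : Tendsto (fun r => c * lowerGrowth r) (𝓝[<] 1) (𝓝 (c * lowerGrowth 1)) :=
      ((hasDerivAt_lowerGrowth zero_le_one).continuousAt.tendsto.mono_left
        nhdsWithin_le_nhds).const_mul c
    obtain ⟨R, hR, hR'⟩ := ((hcont.eventually_const_lt hcw).and
      (Ioo_mem_nhdsLT (zero_lt_one' ℝ))).exists
    exact ⟨R, hR'.1, hR'.2, hR⟩
  have hsub : closedBall (0 : ℂ) R ⊆ unitDisc := closedBall_subset_ball hR1
  -- A penalized minimization: E 0 = |w| < c · `lowerGrowth R`, so a minimizer over the closed disc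
  -- of radius R is interior.
  set E : ℂ → ℝ := fun z => ‖f z - w‖ + c * lowerGrowth ‖z‖ with hE
  have hEc : ContinuousOn E (closedBall 0 R) := by
    refine ((hf.continuousOn.mono hsub).sub continuousOn_const).norm.add
      (continuousOn_const.mul ?_)
    intro z _
    exact ((hasDerivAt_lowerGrowth (norm_nonneg z)).continuousAt.comp
      continuous_norm.continuousAt).continuousWithinAt
  obtain ⟨z, hzR, hmin⟩ := (isCompact_closedBall (0 : ℂ) R).exists_isMinOn
    ⟨0, mem_closedBall_self hR0.le⟩ hEc
  have hEz : E z ≤ ‖w‖ := by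
    have := hmin (mem_closedBall_self hR0.le)
    simpa [hE, h0, hφ0] using this
  have hzlt : ‖z‖ < R := by
    refine lt_of_le_of_ne (mem_closedBall_zero_iff.1 hzR) fun h => ?_
    have : c * lowerGrowth R ≤ E z := by
      simp only [hE, h]
      linarith [norm_nonneg (f z - w)]
    linarith
  have hz : z ∈ unitDisc := hsub hzR
  refine ⟨z, hz, ?_⟩
  by_contra hne
  set A := f z - w with hA
  have hA0 : A ≠ 0 := sub_ne_zero.2 hne
  have hAp : 0 < ‖A‖ := norm_pos_iff.2 hA0
  have hdpos : 0 < (1 - ‖z‖) / (1 + ‖z‖) ^ 2 := by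
    have := mem_unitDisc.1 hz
    exact div_pos (by linarith) (by positivity)
  have hfz := hd z hz
  have hfz0 : deriv f z ≠ 0 := norm_pos_iff.1 (hdpos.trans_le hfz)
  -- The Newton direction: along u, |f - w| falls at rate |A|, while the penalty grows at rate at
  -- most c |A|, contradicting minimality.
  set u := -A / deriv f z with hu
  have hγ : HasDerivAt (fun t : ℝ => f (z + t * u) - w) (-A) 0 := by
    have h1 : HasDerivAt f (deriv f z) (z + ((0 : ℝ) : ℂ) * u) := by
      simpa using (hf.differentiableAt (isOpen_unitDisc.mem_nhds hz)).hasDerivAt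
    have h2 : HasDerivAt (fun t : ℝ => z + t * u) u 0 := by
      simpa using ((ofRealCLM.hasDerivAt (x := (0 : ℝ))).mul_const u).const_add z
    refine ((HasDerivAt.comp (0 : ℝ) h1 h2).sub_const w).congr_deriv ?_
    rw [hu]; field_simp
  have hnγ : HasDerivAt (fun t : ℝ => ‖f (z + t * u) - w‖) (-‖A‖) 0 := by
    have h1 := hγ.norm_sq.sqrt (by simpa [← hA] using hAp.ne')
    simp only [Real.sqrt_sq (norm_nonneg _), ofReal_zero, zero_mul, add_zero, ← hA] at h1
    refine h1.congr_deriv ?_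
    rw [inner_neg_right, real_inner_self_eq_norm_sq]
    field_simp
  have hψ : HasDerivAt (fun t : ℝ => c * lowerGrowth (‖z‖ + t * ‖u‖))
      (c * ((1 - ‖z‖) / (1 + ‖z‖) ^ 2 * ‖u‖)) 0 := by
    have h1 : HasDerivAt lowerGrowth ((1 - ‖z‖) / (1 + ‖z‖) ^ 2) (‖z‖ + 0 * ‖u‖) := by
      simpa using hasDerivAt_lowerGrowth (norm_nonneg z)
    have h2 : HasDerivAt (fun t : ℝ => ‖z‖ + t * ‖u‖) ‖u‖ 0 := by
      simpa using ((hasDerivAt_id (0 : ℝ)).mul_const ‖u‖).const_add ‖z‖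
    exact (HasDerivAt.comp (0 : ℝ) h1 h2).const_mul c
  have hsum := hnγ.add hψ
  have hneg : -‖A‖ + c * ((1 - ‖z‖) / (1 + ‖z‖) ^ 2 * ‖u‖) < 0 := by
    have h1 : (1 - ‖z‖) / (1 + ‖z‖) ^ 2 * ‖u‖ ≤ ‖A‖ := by
      rw [hu, norm_div, norm_neg, mul_div_assoc', div_le_iff₀ (norm_pos_iff.2 hfz0), mul_comm]
      exact mul_le_mul_of_nonneg_left hfz (norm_nonneg _)
    nlinarith
  have hlim := hasDerivAt_iff_tendsto_slope.1 hsum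
  have hlim' := hlim.mono_left (nhdsWithin_mono (0 : ℝ)
    (fun x (hx : x ∈ Ioi (0 : ℝ)) => ne_of_gt hx))
  have hev1 := hlim'.eventually_lt_const hneg
  have hev2 : ∀ᶠ t in 𝓝[>] (0 : ℝ), ‖z‖ + t * ‖u‖ < R := by
    have : Tendsto (fun t : ℝ => ‖z‖ + t * ‖u‖) (𝓝[>] 0) (𝓝 (‖z‖ + 0 * ‖u‖)) :=
      (Continuous.tendsto (by fun_prop) _).mono_left nhdsWithin_le_nhds
    exact this.eventually_lt_const (by simpa using hzlt)
  obtain ⟨t, ⟨ht1, ht2⟩, ht0⟩ := ((hev1.and hev2).and self_mem_nhdsWithin).exists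
  have ht0' : 0 < t := ht0
  rw [slope_def_field, sub_zero, div_neg_iff] at ht1
  have ht3 := (ht1.resolve_left fun h => absurd h.2 (not_lt.2 ht0'.le)).1
  have hn : ‖z + t * u‖ ≤ ‖z‖ + t * ‖u‖ := by
    refine (norm_add_le _ _).trans ?_
    rw [norm_mul, norm_real, Real.norm_of_nonneg ht0'.le]
  have h4 := hmin (mem_closedBall_zero_iff.2 (hn.trans ht2.le))
  have h5 : lowerGrowth ‖z + t * u‖ ≤ lowerGrowth (‖z‖ + t * ‖u‖) :=
    monotoneOn_lowerGrowth ⟨norm_nonneg _, by linarith⟩ ⟨by positivity, by linarith⟩ hn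
  simp only [Pi.add_apply, ofReal_zero, zero_mul, add_zero, ← hA] at ht3
  simp only [hE, mem_ofPred_eq, ← hA] at h4
  nlinarith

/-! ### Univalence by deformation to the convex function. -/

section Deformation

variable {f g : ℂ → ℂ}

/-- The linear isomorphism `(z, τ) ↦ (A z + B τ, τ)`. -/
noncomputable def shearEquiv (A B : ℂ) (hA : A ≠ 0) : (ℂ × ℂ) ≃L[ℂ] ℂ × ℂ :=
  ContinuousLinearEquiv.equivOfInverse
    ((A • ContinuousLinearMap.fst ℂ ℂ ℂ + B • ContinuousLinearMap.snd ℂ ℂ ℂ).prod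
      (ContinuousLinearMap.snd ℂ ℂ ℂ))
    ((A⁻¹ • (ContinuousLinearMap.fst ℂ ℂ ℂ - B • ContinuousLinearMap.snd ℂ ℂ ℂ)).prod
      (ContinuousLinearMap.snd ℂ ℂ ℂ))
    (fun x => by ext <;> simp [hA]) (fun x => by ext <;> simp [hA])

lemma shearEquiv_symm_apply (A B : ℂ) (hA : A ≠ 0) (x : ℂ × ℂ) :
    (shearEquiv A B hA).symm x = (A⁻¹ * (x.1 - B * x.2), x.2) := rfl

/-- The deformation `(z, τ) ↦ (τ f(z) + (1 - τ) g(z), τ)`. -/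
def deformation (f g : ℂ → ℂ) (p : ℂ × ℂ) : ℂ × ℂ := (p.2 * f p.1 + (1 - p.2) * g p.1, p.2)

lemma hasStrictFDerivAt_deformation (hf : DifferentiableOn ℂ f unitDisc)
    (hg : DifferentiableOn ℂ g unitDisc) {c : ℂ} (hc : c ∈ unitDisc) {τ : ℂ}
    (hA : τ * deriv f c + (1 - τ) * deriv g c ≠ 0) :
    HasStrictFDerivAt (deformation f g)
      (shearEquiv (τ * deriv f c + (1 - τ) * deriv g c) (f c - g c) hA : ℂ × ℂ →L[ℂ] ℂ × ℂ)
      (c, τ) := by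
  have hD := isOpen_unitDisc.mem_nhds hc
  have h1 : HasStrictDerivAt f (deriv f c) (c, τ).1 := (hf.analyticAt hD).hasStrictDerivAt
  have h2 : HasStrictDerivAt g (deriv g c) (c, τ).1 := (hg.analyticAt hD).hasStrictDerivAt
  have hfst : HasStrictFDerivAt (Prod.fst : ℂ × ℂ → ℂ) (ContinuousLinearMap.fst ℂ ℂ ℂ) (c, τ) :=
    hasStrictFDerivAt_fst
  have hsnd : HasStrictFDerivAt (Prod.snd : ℂ × ℂ → ℂ) (ContinuousLinearMap.snd ℂ ℂ ℂ) (c, τ) :=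
    hasStrictFDerivAt_snd
  have h3 := h1.hasStrictFDerivAt.comp (c, τ) hfst
  have h4 := h2.hasStrictFDerivAt.comp (c, τ) hfst
  have h5 := ((hsnd.mul h3).add ((hsnd.const_sub 1).mul h4)).prodMk hsnd
  refine h5.congr_fderiv ?_
  ext <;> (simp [shearEquiv]; try ring)

/-- Local uniqueness of solutions of `τ f(z) + (1 - τ) g(z) = w`. -/
lemma eventually_eq_of_deformation_eq (hf : DifferentiableOn ℂ f unitDisc)
    (hg : DifferentiableOn ℂ g unitDisc) {c : ℂ} (hc : c ∈ unitDisc) {τ : ℝ}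
    (hA : (τ : ℂ) * deriv f c + (1 - τ) * deriv g c ≠ 0) :
    ∀ᶠ p : (ℂ × ℂ) × ℝ in 𝓝 ((c, c), τ),
      (p.2 : ℂ) * f p.1.1 + (1 - p.2) * g p.1.1 = p.2 * f p.1.2 + (1 - p.2) * g p.1.2 →
      p.1.1 = p.1.2 := by
  have h := (hasStrictFDerivAt_deformation hf hg hc hA).eventually_left_inverse
  have h1 : Tendsto (fun p : (ℂ × ℂ) × ℝ => (p.1.1, (p.2 : ℂ))) (𝓝 ((c, c), τ))
      (𝓝 (c, (τ : ℂ))) := by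
    apply Continuous.tendsto' (by fun_prop); rfl
  have h2 : Tendsto (fun p : (ℂ × ℂ) × ℝ => (p.1.2, (p.2 : ℂ))) (𝓝 ((c, c), τ))
      (𝓝 (c, (τ : ℂ))) := by
    apply Continuous.tendsto' (by fun_prop); rfl
  filter_upwards [h1.eventually h, h2.eventually h] with p hp1 hp2 he
  have h3 : deformation f g (p.1.1, (p.2 : ℂ)) = deformation f g (p.1.2, (p.2 : ℂ)) := by
    simp only [deformation, he]
  rw [h3] at hp1
  exact congrArg Prod.fst (hp1.symm.trans hp2)

/-- Solutions of `τ f(z) + (1 - τ) g(z) = τ w` move towards the origin as `τ` decreases. -/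
lemma exists_inward_curve (hf : DifferentiableOn ℂ f unitDisc)
    (hg : DifferentiableOn ℂ g unitDisc) {R : ℝ} (hR0 : 0 < R) (hR : R < 1)
    {c : ℂ} (hc : ‖c‖ ≤ R) {τ : ℝ} (hτ : 0 < τ)
    (hA : (τ : ℂ) * deriv f c + (1 - τ) * deriv g c ≠ 0)
    (hre : c ≠ 0 → 0 < (c * ((τ : ℂ) * deriv f c + (1 - τ) * deriv g c) / g c).re) :
    ∃ a : ℝ → ℂ, ContinuousAt a τ ∧ a τ = c ∧ ∀ᶠ t in 𝓝[<] τ, ‖a t‖ ≤ R ∧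
      (t : ℂ) * f (a t) + (1 - t) * g (a t) = t * ((τ * f c + (1 - τ) * g c) / τ) := by
  have hcD : c ∈ unitDisc := mem_unitDisc.2 (hc.trans_lt hR)
  have hτ0 : (τ : ℂ) ≠ 0 := ofReal_ne_zero.2 hτ.ne'
  have hst := hasStrictFDerivAt_deformation hf hg hcD hA
  set A := (τ : ℂ) * deriv f c + (1 - τ) * deriv g c with hAdef
  set w := (τ * f c + (1 - τ) * g c) / τ with hw
  set L := hst.localInverse with hL
  have hcw : ((τ : ℂ) * w, (τ : ℂ)) = deformation f g (c, τ) := by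
    rw [hw, mul_div_cancel₀ _ hτ0, deformation]
  have hLc : L ((τ : ℂ) * w, (τ : ℂ)) = (c, (τ : ℂ)) := by
    rw [hcw]; exact hst.localInverse_apply_image
  have hpath : HasDerivAt (fun t : ℝ => ((t : ℂ) * w, (t : ℂ))) (w, 1) τ := by
    have h1 : HasDerivAt (fun t : ℝ => (t : ℂ)) 1 τ := ofRealCLM.hasDerivAt
    simpa using (h1.mul_const w).prodMk h1
  have hLd : HasFDerivAt L ((shearEquiv A (f c - g c) hA).symm : ℂ × ℂ →L[ℂ] ℂ × ℂ)
      ((τ : ℂ) * w, (τ : ℂ)) := by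
    rw [hcw]; exact hst.to_localInverse.hasFDerivAt
  have hcomp : HasDerivAt (fun t : ℝ => L ((t : ℂ) * w, (t : ℂ)))
      ((shearEquiv A (f c - g c) hA).symm (w, 1)) τ := by
    have hLr : HasFDerivAt L
        (((shearEquiv A (f c - g c) hA).symm : ℂ × ℂ →L[ℂ] ℂ × ℂ).restrictScalars ℝ)
        ((τ : ℂ) * w, (τ : ℂ)) := hLd.restrictScalars ℝ
    exact hLr.comp_hasDerivAt τ hpath
  set a : ℝ → ℂ := fun t => (L ((t : ℂ) * w, (t : ℂ))).1 with ha
  have had : HasDerivAt a (A⁻¹ * (w - (f c - g c))) τ := by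
    have h1 : HasFDerivAt (Prod.fst : ℂ × ℂ → ℂ) (ContinuousLinearMap.fst ℝ ℂ ℂ)
      (L ((τ : ℂ) * w, (τ : ℂ))) := hasFDerivAt_fst
    refine (h1.comp_hasDerivAt τ hcomp).congr_deriv ?_
    simp [shearEquiv_symm_apply]
  have haτ : a τ = c := by simp only [ha, hLc]
  refine ⟨a, had.continuousAt, haτ, ?_⟩
  have hsol : ∀ᶠ t : ℝ in 𝓝 τ, (t : ℂ) * f (a t) + (1 - t) * g (a t) = t * w := by
    have h1 := hst.eventually_right_inverse
    rw [← hcw] at h1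
    filter_upwards [hpath.continuousAt.tendsto.eventually h1] with t ht
    have h2 := congrArg Prod.snd ht
    have h3 := congrArg Prod.fst ht
    simp only [deformation] at h2 h3
    rw [h2] at h3
    exact h3
  suffices hnorm : ∀ᶠ t in 𝓝[<] τ, ‖a t‖ ≤ R from
    hnorm.and (hsol.filter_mono nhdsWithin_le_nhds)
  by_cases hc0 : c = 0
  · have h1 : Tendsto (fun t => ‖a t‖) (𝓝[<] τ) (𝓝 ‖a τ‖) :=
      had.continuousAt.norm.tendsto.mono_left nhdsWithin_le_nhds
    rw [haτ, hc0, norm_zero] at h1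
    exact (h1.eventually_lt_const hR0).mono fun t ht => ht.le
  · have hgc : g c ≠ 0 := by
      intro h; have := hre hc0; simp [h] at this
    -- The velocity is g c / (τ A). Its inner product with c has the sign of Re (c A / g c) > 0, so
    -- |a t| increases with t at τ and is smaller just before.
    have hvel : A⁻¹ * (w - (f c - g c)) = A⁻¹ * (g c / τ) := by
      rw [hw]; congr 1; field_simp; ring
    rw [hvel] at had
    have hin : 0 < inner ℝ c (A⁻¹ * (g c / τ)) := by
      have h1 : A⁻¹ * (g c / τ) * (starRingEnd ℂ) c =
          ((normSq c / τ : ℝ) : ℂ) * (c * A / g c)⁻¹ := by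
        push_cast
        rw [← mul_conj]
        field_simp
      rw [Complex.inner, h1, re_ofReal_mul, inv_re]
      have h2 := hre hc0
      have h3 : c * A / g c ≠ 0 := by intro h; rw [h] at h2; simp at h2
      exact mul_pos (div_pos (normSq_pos.2 hc0) hτ) (div_pos h2 (normSq_pos.2 h3))
    have hsq := had.norm_sq
    rw [haτ] at hsq
    have hlim := (hasDerivAt_iff_tendsto_slope.1 hsq).mono_left
      (nhdsWithin_mono τ (fun x (hx : x ∈ Iio τ) => ne_of_lt hx))
    have hev := hlim.eventually_const_lt (mul_pos two_pos hin)
    filter_upwards [hev, self_mem_nhdsWithin] with t ht1 ht2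
    have ht2' : t < τ := ht2
    rw [slope_def_field, div_pos_iff] at ht1
    have h4 := (ht1.resolve_left fun h => absurd h.2 (by linarith)).1
    rw [haτ, sub_neg, sq_lt_sq₀ (norm_nonneg _) (norm_nonneg _)] at h4
    exact h4.le.trans hc

/-- Close-to-convexity implies univalence. -/
lemma injOn_of_re_pos (hf : DifferentiableOn ℂ f unitDisc) (hf1 : deriv f 0 = 1)
    (hg : IsConvexUnivalent g) (hg1 : 0 < (deriv g 0).re)
    (hre : ∀ z ∈ unitDisc, z ≠ 0 → 0 < (z * deriv f z / g z).re) : InjOn f unitDisc := by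
  -- The condition is affine in τ: it holds for f by hypothesis and for g by starlikeness.
  have hreτ : ∀ τ ∈ Icc (0 : ℝ) 1, ∀ z ∈ unitDisc, z ≠ 0 →
      0 < (z * ((τ : ℂ) * deriv f z + (1 - τ) * deriv g z) / g z).re := by
    intro τ hτ z hz hz0
    have h1 := hre z hz hz0
    have h2 := hg.re_pos hz hz0
    have h3 : z * ((τ : ℂ) * deriv f z + (1 - τ) * deriv g z) / g z =
        (τ : ℂ) * (z * deriv f z / g z) + ((1 - τ : ℝ) : ℂ) * (z * deriv g z / g z) := by
      push_cast; ring
    rw [h3, add_re, re_ofReal_mul, re_ofReal_mul]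
    rcases hτ.1.eq_or_lt with h | h
    · rw [← h]; simpa using h2
    · have := mul_nonneg (sub_nonneg.2 hτ.2) h2.le
      have := mul_pos h h1
      linarith
  have hA : ∀ τ ∈ Icc (0 : ℝ) 1, ∀ z ∈ unitDisc,
      (τ : ℂ) * deriv f z + (1 - τ) * deriv g z ≠ 0 := by
    intro τ hτ z hz h
    by_cases hz0 : z = 0
    · have h1 := congrArg re h
      have h2 : (1 - τ : ℂ) = ((1 - τ : ℝ) : ℂ) := by push_cast; rfl
      rw [hz0, hf1, mul_one, h2, add_re, re_ofReal_mul, ofReal_re, zero_re] at h1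
      rcases hτ.1.eq_or_lt with h3 | h3
      · rw [← h3] at h1; simp at h1; linarith
      · have := mul_nonneg (sub_nonneg.2 hτ.2) hg1.le
        linarith
    · have := hreτ τ hτ z hz hz0
      rw [h] at this; simp at this
  intro x hx y hy hxy
  by_contra hne
  obtain ⟨R, hR0, hR1, hxR, hyR⟩ : ∃ R, 0 < R ∧ R < 1 ∧ ‖x‖ ≤ R ∧ ‖y‖ ≤ R := by
    obtain ⟨R, h1, h2⟩ := exists_between
      (max_lt zero_lt_one (max_lt (mem_unitDisc.1 hx) (mem_unitDisc.1 hy)))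
    simp only [max_lt_iff] at h1
    exact ⟨R, h1.1, h2, h1.2.1.le, h1.2.2.le⟩
  have hsub : closedBall (0 : ℂ) R ⊆ unitDisc := closedBall_subset_ball hR1
  set G : (ℂ × ℂ) × ℝ → ℂ := fun p =>
    ((p.2 : ℂ) * f p.1.1 + (1 - p.2) * g p.1.1) - (p.2 * f p.1.2 + (1 - p.2) * g p.1.2) with hG
  set S : Set ((ℂ × ℂ) × ℝ) := (closedBall 0 R ×ˢ closedBall 0 R) ×ˢ Icc 0 1 with hS
  have hSc : IsCompact S :=
    ((isCompact_closedBall _ _).prod (isCompact_closedBall _ _)).prod isCompact_Icc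
  have hGc : ContinuousOn G S := by
    have hp1 : MapsTo (fun p : (ℂ × ℂ) × ℝ => p.1.1) S unitDisc := fun p hp => hsub hp.1.1
    have hp2 : MapsTo (fun p : (ℂ × ℂ) × ℝ => p.1.2) S unitDisc := fun p hp => hsub hp.1.2
    have hf1 := hf.continuousOn.comp (f := fun p : (ℂ × ℂ) × ℝ => p.1.1) (by fun_prop) hp1
    have hf2 := hf.continuousOn.comp (f := fun p : (ℂ × ℂ) × ℝ => p.1.2) (by fun_prop) hp2
    have hg1 := hg.diff.continuousOn.comp (f := fun p : (ℂ × ℂ) × ℝ => p.1.1) (by fun_prop) hp1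
    have hg2 := hg.diff.continuousOn.comp (f := fun p : (ℂ × ℂ) × ℝ => p.1.2) (by fun_prop) hp2
    have ht : ContinuousOn (fun p : (ℂ × ℂ) × ℝ => (p.2 : ℂ)) S := by fun_prop
    have ht' : ContinuousOn (fun p : (ℂ × ℂ) × ℝ => (1 - p.2 : ℂ)) S := by fun_prop
    exact ((ht.mul hf1).add (ht'.mul hg1)).sub ((ht.mul hf2).add (ht'.mul hg2))
  set K : Set ((ℂ × ℂ) × ℝ) := {p | p ∈ S ∧ G p = 0 ∧ p.1.1 ≠ p.1.2} with hK
  have hCcl : IsClosed (S ∩ G ⁻¹' {0}) :=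
    hGc.preimage_isClosed_of_isClosed hSc.isClosed isClosed_singleton
  -- Distinct colliding pairs cannot converge to the diagonal, by local uniqueness at the limit
  -- point.
  have hKcl : IsClosed K := by
    refine isClosed_of_closure_subset fun p hp => ?_
    have hpC : p ∈ S ∩ G ⁻¹' {0} := closure_minimal
      (show K ⊆ S ∩ G ⁻¹' {0} from fun q hq => ⟨hq.1, hq.2.1⟩) hCcl hp
    refine ⟨hpC.1, hpC.2, fun he => ?_⟩
    obtain ⟨⟨a, b⟩, τ⟩ := p
    simp only at he
    subst he
    have h1 := eventually_eq_of_deformation_eq hf hg.diff (hsub hpC.1.1.1)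
      (hA τ hpC.1.2 a (hsub hpC.1.1.1))
    obtain ⟨q, hq, hq2⟩ := (mem_closure_iff_frequently.1 hp |>.and_eventually h1).exists
    exact hq.2.2 (hq2 (sub_eq_zero.1 hq.2.1))
  have hKcomp : IsCompact K := hSc.of_isClosed_subset hKcl fun p hp => hp.1
  have hKne : K.Nonempty := by
    refine ⟨((x, y), 1), ⟨⟨⟨?_, ?_⟩, ?_⟩, ?_, hne⟩⟩
    · simpa using hxR
    · simpa using hyR
    · simp
    · simp [hG, hxy]
  -- Take a collision with least τ; τ > 0 because g is injective. The inward curves from a and b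
  -- solve the same equation for t slightly below τ and remain distinct, giving an earlier
  -- collision.
  obtain ⟨⟨⟨a, b⟩, τ⟩, hp, hmin⟩ := hKcomp.exists_isMinOn hKne
    (f := fun p : (ℂ × ℂ) × ℝ => p.2) (by fun_prop)
  obtain ⟨⟨⟨haR, hbR⟩, hτ⟩, hGp, hab⟩ := hp
  simp only [hG] at haR hbR hτ hGp hab
  have hτ0 : 0 < τ := by
    refine lt_of_le_of_ne hτ.1 fun h => ?_
    rw [← h] at hGp
    simp only [ofReal_zero, zero_mul, sub_zero, one_mul, zero_add] at hGp
    exact hab (hg.inj (hsub haR) (hsub hbR) (sub_eq_zero.1 hGp))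
  obtain ⟨α, hαc, hα, hαe⟩ := exists_inward_curve hf hg.diff hR0 hR1
    (mem_closedBall_zero_iff.1 haR) hτ0 (hA τ hτ a (hsub haR)) (hreτ τ hτ a (hsub haR))
  obtain ⟨β, hβc, hβ, hβe⟩ := exists_inward_curve hf hg.diff hR0 hR1
    (mem_closedBall_zero_iff.1 hbR) hτ0 (hA τ hτ b (hsub hbR)) (hreτ τ hτ b (hsub hbR))
  have hneq : ∀ᶠ t in 𝓝[<] τ, α t ≠ β t := by
    have h1 : ∀ᶠ t in 𝓝 τ, α t - β t ≠ 0 :=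
      (hαc.sub hβc).eventually_ne (by simpa [hα, hβ, sub_eq_zero] using hab)
    exact (h1.filter_mono nhdsWithin_le_nhds).mono fun t ht => sub_ne_zero.1 ht
  obtain ⟨t, ⟨⟨⟨ha1, ha2⟩, hb1, hb2⟩, hn⟩, ht0, htτ⟩ :=
    (((hαe.and hβe).and hneq).and (Ioo_mem_nhdsLT hτ0)).exists
  have hmem : ((α t, β t), t) ∈ K := by
    refine ⟨⟨⟨?_, ?_⟩, ht0.le, htτ.le.trans hτ.2⟩, ?_, hn⟩
    · simpa using ha1
    · simpa using hb1
    · simp only [hG]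
      rw [ha2, hb2, sub_eq_zero.1 hGp, sub_self]
  exact absurd (hmin hmem) (not_le.2 htτ)

end Deformation

/-! ### Lower bound for the boundary distance. -/

lemma IsClassC1.injOn {f : ℂ → ℂ} (hf : IsClassC1 f) : InjOn f unitDisc := by
  obtain ⟨g, p, hg, hg1, hre, -⟩ := hf.exists_factorization
  exact injOn_of_re_pos hf.analytic hf.deriv_zero hg hg1 hre

/-- A univalent image of the disc is not the whole plane. -/
lemma image_ne_univ {f : ℂ → ℂ} (hf : DifferentiableOn ℂ f unitDisc) (hi : InjOn f unitDisc) :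
    f '' unitDisc ≠ univ := by
  intro h
  have hd := differentiableOn_invFunOn isOpen_unitDisc hf hi
  rw [h, differentiableOn_univ] at hd
  have hb : Bornology.IsBounded (range (Function.invFunOn f unitDisc)) := by
    refine isBounded_ball.subset (t := unitDisc) ?_
    rintro _ ⟨w, rfl⟩
    have hw : w ∈ f '' unitDisc := by rw [h]; trivial
    exact Function.invFunOn_mem hw
  have hx : ((1 / 2 : ℝ) : ℂ) ∈ unitDisc := by
    rw [mem_unitDisc, norm_real]; norm_num
  have h1 := hd.apply_eq_apply_of_bounded hb (f 0) (f ((1 / 2 : ℝ) : ℂ))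
  rw [hi.leftInvOn_invFunOn zero_mem_unitDisc, hi.leftInvOn_invFunOn hx] at h1
  have := congrArg re h1
  norm_num at this

/-- Needed because `Metric.infDist` to the empty set is 0, which would defeat the lower bound. -/
lemma IsClassC1.frontier_nonempty {f : ℂ → ℂ} (hf : IsClassC1 f) :
    (frontier (f '' unitDisc)).Nonempty := by
  rw [nonempty_iff_ne_empty]
  intro h
  rcases isClopen_iff.1 (isClopen_iff_frontier_eq_empty.2 h) with h1 | h1
  · exact (image_nonempty.2 ⟨0, zero_mem_unitDisc⟩).ne_empty h1
  · exact image_ne_univ hf.analytic hf.injOn h1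

lemma IsClassC1.le_boundaryDist {f : ℂ → ℂ} (hf : IsClassC1 f) :
    1 - Real.log 2 ≤ boundaryDist f := by
  refine (le_infDist hf.frontier_nonempty).2 fun w hw => ?_
  rw [hf.map_zero, dist_zero_left]
  by_contra hlt
  push Not at hlt
  have h1 := ball_subset_image hf.analytic hf.map_zero (fun z hz => hf.le_norm_deriv hz)
    (mem_ball_zero_iff.2 hlt)
  have hopen := isOpen_image_of_injOn isOpen_unitDisc hf.analytic hf.injOn
  rw [hopen.frontier_eq] at hw
  exact hw.2 h1

/-! ### The extremal function. -/

/-- The upper growth function `2r/(1-r) + log(1-r)`. -/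
noncomputable def upperGrowth (r : ℝ) : ℝ := 2 * r / (1 - r) + Real.log (1 - r)

/-- The extremal function `2z/(1-z) + log(1-z)`. -/
noncomputable def extremal (z : ℂ) : ℂ := 2 * z / (1 - z) + log (1 - z)

/-- The coefficients `2 - 1/n` (and `0` for `n = 0`) of the extremal function. -/
noncomputable def extremalCoeff (n : ℕ) : ℝ := (if n = 0 then 0 else 2) - 1 / (n : ℝ)

lemma extremalCoeff_of_ne_zero {n : ℕ} (hn : n ≠ 0) : extremalCoeff n = 2 - 1 / (n : ℝ) := by
  simp [extremalCoeff, hn]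

lemma extremalCoeff_nonneg (n : ℕ) : 0 ≤ extremalCoeff n := by
  by_cases hn : n = 0
  · simp [extremalCoeff, hn]
  · rw [extremalCoeff_of_ne_zero hn]
    have h1 : (1 : ℝ) ≤ n := by exact_mod_cast Nat.one_le_iff_ne_zero.2 hn
    have : 1 / (n : ℝ) ≤ 1 := div_le_one_of_le₀ h1 (by positivity)
    linarith

lemma one_sub_ne_zero {z : ℂ} (hz : z ∈ unitDisc) : 1 - z ≠ 0 := by
  intro h
  rw [← sub_eq_zero.1 h, mem_unitDisc, norm_one] at hz
  exact lt_irrefl _ hz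

lemma re_one_sub_pos {z : ℂ} (hz : z ∈ unitDisc) : 0 < (1 - z).re := by
  have := (re_le_norm z).trans_lt (mem_unitDisc.1 hz)
  rw [sub_re, one_re]; linarith

lemma hasSum_extremal {z : ℂ} (hz : z ∈ unitDisc) :
    HasSum (fun n => (extremalCoeff n : ℂ) * z ^ n) (extremal z) := by
  have h1 := (hasSum_geometric_of_norm_lt_one (mem_unitDisc.1 hz)).mul_left 2
  have h2 := h1.sub (hasSum_ite_eq (0 : ℕ) (2 : ℂ))
  have h3 := h2.sub (hasSum_taylorSeries_neg_log (mem_unitDisc.1 hz))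
  have h0 := one_sub_ne_zero hz
  have he : extremal z = 2 * (1 - z)⁻¹ - 2 - -log (1 - z) := by
    rw [extremal]
    field_simp
    ring
  rw [he]
  refine h3.congr_fun fun n => ?_
  by_cases hn : n = 0
  · simp [hn, extremalCoeff]
  · rw [extremalCoeff_of_ne_zero hn]
    simp [hn]
    ring

lemma extremal_ofReal {r : ℝ} (hr : r < 1) : extremal r = (upperGrowth r : ℂ) := by
  rw [extremal, upperGrowth]
  push_cast
  rw [ofReal_log (by linarith)]
  push_cast
  rfl

lemma hasSum_upperGrowth {r : ℝ} (hr0 : 0 ≤ r) (hr : r < 1) :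
    HasSum (fun n => extremalCoeff n * r ^ n) (upperGrowth r) := by
  have hz : (r : ℂ) ∈ unitDisc := by
    rwa [mem_unitDisc, norm_real, Real.norm_of_nonneg hr0]
  have h := hasSum_extremal hz
  rw [extremal_ofReal hr] at h
  rw [← hasSum_ofReal]
  exact_mod_cast h

/-- The interval reaches down to -1 because the boundary value there determines the boundary
distance of `extremal`. -/
lemma strictMonoOn_upperGrowth : StrictMonoOn upperGrowth (Ico (-1) 1) := by
  have hd : ∀ r < 1, HasDerivAt upperGrowth ((1 + r) / (1 - r) ^ 2) r := by
    intro r hr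
    have h1 : 1 - r ≠ 0 := by linarith
    have h2 : HasDerivAt (fun r : ℝ => 1 - r) (-1) r := (hasDerivAt_id r).const_sub 1
    have h3 : HasDerivAt (fun r : ℝ => 2 * r) 2 r := by
      simpa using (hasDerivAt_id r).const_mul 2
    refine ((h3.fun_div h2 h1).add (h2.log h1)).congr_deriv ?_
    field_simp
    ring
  refine strictMonoOn_of_deriv_pos (convex_Ico (-1) 1)
    (fun r hr => (hd r hr.2).continuousAt.continuousWithinAt) fun r hr => ?_
  rw [interior_Ico] at hr
  rw [(hd r hr.2).deriv]
  have h1 : 0 < 1 - r := by linarith [hr.2]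
  exact div_pos (by linarith [hr.1]) (by positivity)

lemma upperGrowth_zero : upperGrowth 0 = 0 := by simp [upperGrowth]

lemma differentiableOn_extremal : DifferentiableOn ℂ extremal unitDisc :=
  differentiableOn_of_hasSum fun _ hz => hasSum_extremal hz

lemma taylorCoeff_extremal (n : ℕ) : taylorCoeff extremal n = extremalCoeff n :=
  taylorCoeff_eq_of_hasSum (c := fun n => (extremalCoeff n : ℂ))
    (fun _ hz => hasSum_extremal hz) n

lemma hasDerivAt_extremal {z : ℂ} (hz : z ∈ unitDisc) :
    HasDerivAt extremal ((1 + z) / (1 - z) ^ 2) z := by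
  have h1 := one_sub_ne_zero hz
  have h2 : HasDerivAt (fun z : ℂ => 1 - z) (-1) z := (hasDerivAt_id z).const_sub 1
  have h3 : HasDerivAt (fun z : ℂ => 2 * z) 2 z := by
    simpa using (hasDerivAt_id z).const_mul 2
  refine ((h3.fun_div h2 h1).add (h2.clog (Or.inl (re_one_sub_pos hz)))).congr_deriv ?_
  field_simp
  ring

/-- The image is the half-plane Re w > -1/2, with inverse map w / (1 + w). -/
lemma isConvexFunction_div_one_sub : IsConvexFunction fun z => z / (1 - z) where
  analytic := DifferentiableOn.div (by fun_prop) (by fun_prop) fun z hz => one_sub_ne_zero hz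
  univalent := by
    intro x hx y hy h
    have h1 := one_sub_ne_zero hx
    have h2 := one_sub_ne_zero hy
    simp only at h
    rw [div_eq_div_iff h1 h2] at h
    linear_combination h
  convex_image := by
    have : (fun z : ℂ => z / (1 - z)) '' unitDisc = {w | -(1 / 2 : ℝ) < w.re} := by
      have hnorm : ∀ w : ℂ, ‖w‖ < ‖1 + w‖ ↔ -(1 / 2 : ℝ) < w.re := by
        intro w
        rw [← sq_lt_sq₀ (norm_nonneg _) (norm_nonneg _), ← normSq_eq_norm_sq,
          ← normSq_eq_norm_sq]
        simp only [normSq_apply, add_re, add_im, one_re, one_im]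
        constructor <;> intro h <;> linarith
      ext w
      rw [mem_ofPred_eq, ← hnorm]
      constructor
      · rintro ⟨z, hz, rfl⟩
        have h1 := one_sub_ne_zero hz
        have h2 : 1 + z / (1 - z) = 1 / (1 - z) := by field_simp; ring
        simp only [h2, norm_div, norm_one]
        exact div_lt_div_of_pos_right (mem_unitDisc.1 hz) (norm_pos_iff.2 h1)
      · intro h
        have hp : 0 < ‖1 + w‖ := (norm_nonneg _).trans_lt h
        have hne : 1 + w ≠ 0 := norm_pos_iff.1 hp
        refine ⟨w / (1 + w), ?_, ?_⟩
        · rw [mem_unitDisc, norm_div, div_lt_one hp]; exact h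
        · have h3 : 1 - w / (1 + w) = 1 / (1 + w) := by field_simp; ring
          simp only [h3]
          field_simp
    rw [this]
    exact convex_halfSpace_re_gt _
  map_zero := by simp
  re_deriv_zero_pos := by
    have h2 : HasDerivAt (fun z : ℂ => 1 - z) (-1) 0 := (hasDerivAt_id 0).const_sub 1
    have h3 := ((hasDerivAt_id (0 : ℂ)).fun_div h2 (by simp)).deriv
    simp only [id_eq] at h3
    rw [h3]; simp

lemma isClassC1_extremal : IsClassC1 extremal where
  analytic := differentiableOn_extremal
  map_zero := by simp [extremal]
  deriv_zero := by rw [(hasDerivAt_extremal zero_mem_unitDisc).deriv]; simp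
  exists_convex := by
    refine ⟨_, isConvexFunction_div_one_sub, fun z hz hz0 => ?_⟩
    have h1 := one_sub_ne_zero hz
    have h2 : z * deriv extremal z / (z / (1 - z)) = (1 + z) / (1 - z) := by
      rw [(hasDerivAt_extremal hz).deriv]; field_simp
    rw [h2, div_re, ← add_div]
    refine div_pos ?_ (normSq_pos.2 h1)
    have h3 : normSq z < 1 := by
      rw [normSq_eq_norm_sq]
      exact pow_lt_one₀ (norm_nonneg _) (mem_unitDisc.1 hz) two_ne_zero
    rw [normSq_apply] at h3
    simp only [add_re, sub_re, add_im, sub_im, one_re, one_im]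
    linarith

/-- The extremal function takes real values only on the real axis. -/
lemma im_eq_zero_of_extremal_im_eq_zero {z : ℂ} (hz : z ∈ unitDisc) (h : (extremal z).im = 0) :
    z.im = 0 := by
  set x := 1 - z with hx
  have hx0 : x ≠ 0 := one_sub_ne_zero hz
  have hxr : 0 < x.re := re_one_sub_pos hz
  have hn : normSq x < 2 * x.re := by
    have h3 : normSq z < 1 := by
      rw [normSq_eq_norm_sq]
      exact pow_lt_one₀ (norm_nonneg _) (mem_unitDisc.1 hz) two_ne_zero
    rw [normSq_apply] at h3 ⊢
    simp only [hx, sub_re, sub_im, one_re, one_im]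
    linarith
  have hnp : 0 < normSq x := normSq_pos.2 hx0
  have h1 : extremal z = 2 * x⁻¹ - 2 + log x := by
    rw [extremal, ← hx]
    have : z = 1 - x := by rw [hx]; ring
    rw [this]
    field_simp
  have h2 : arg x = 2 * (x.im / normSq x) := by
    rw [h1] at h
    simp only [add_im, sub_im, mul_im, inv_im, log_im, re_ofNat, im_ofNat, zero_mul, add_zero,
      sub_zero, neg_div] at h
    linarith
  have harg := abs_lt.1 (abs_arg_lt_pi_div_two_iff.2 (Or.inl hxr))
  have htan : Real.tan (arg x) = x.im / x.re := tan_arg x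
  -- With x = 1 - z, |z| < 1 reads |x|² < 2 Re x. A nonzero Im x would therefore make |arg x| = 2
  -- |Im x| / |x|² exceed |Im x| / Re x = tan |arg x|, contradicting θ ≤ tan θ.
  have hdiv : ∀ y : ℝ, 0 < y → y / x.re < 2 * (y / normSq x) := by
    intro y hy
    rw [mul_div_assoc', div_lt_div_iff₀ hxr hnp]
    nlinarith
  have hxim : x.im = 0 := by
    rcases lt_trichotomy x.im 0 with hlt | heq | hgt
    · have h3 := hdiv (-x.im) (by linarith)
      have h4 : arg x ≤ 0 := by
        rw [h2]
        have := div_neg_of_neg_of_pos hlt hnp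
        linarith
      have h5 := Real.le_tan (neg_nonneg.2 h4) (by linarith)
      rw [Real.tan_neg, htan, h2] at h5
      rw [neg_div, neg_div] at h3
      linarith
    · exact heq
    · have h3 := hdiv x.im hgt
      have h4 : 0 ≤ arg x := by
        rw [h2]
        have := div_pos hgt hnp
        linarith
      have h5 := Real.le_tan h4 harg.2
      rw [htan, h2] at h5
      linarith
  simpa [hx] using hxim

lemma log_two_lt_one : Real.log 2 < 1 := Real.log_two_lt_d9.trans (by norm_num)

/-- The radial limit at -1 lies in the closure of the image. It is not a value: real values occur
only on the real axis, where the function is strictly increasing. -/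
lemma boundaryDist_extremal : boundaryDist extremal = 1 - Real.log 2 := by
  refine le_antisymm ?_ isClassC1_extremal.le_boundaryDist
  have hlog := log_two_lt_one
  have hneg1 : upperGrowth (-1) = -(1 - Real.log 2) := by
    norm_num [upperGrowth]
    ring
  have hnot : ((upperGrowth (-1) : ℝ) : ℂ) ∉ extremal '' unitDisc := by
    rintro ⟨z, hz, he⟩
    have him := im_eq_zero_of_extremal_im_eq_zero hz (by rw [he, ofReal_im])
    obtain ⟨x, rfl⟩ : ∃ x : ℝ, z = x := ⟨z.re, by apply Complex.ext <;> simp [him]⟩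
    rw [mem_unitDisc, norm_real, Real.norm_eq_abs, abs_lt] at hz
    rw [extremal_ofReal hz.2, ofReal_inj] at he
    exact (strictMonoOn_upperGrowth ⟨le_rfl, by norm_num⟩ ⟨hz.1.le, hz.2⟩ hz.1).ne' he
  have hcl : ((upperGrowth (-1) : ℝ) : ℂ) ∈ closure (extremal '' unitDisc) := by
    have hc : ContinuousAt upperGrowth (-1) := by
      unfold upperGrowth
      refine ContinuousAt.add (ContinuousAt.div (by fun_prop) (by fun_prop) (by norm_num))
        (ContinuousAt.log (by fun_prop) (by norm_num))
    have ht : Tendsto (fun r => ((upperGrowth r : ℝ) : ℂ)) (𝓝[>] (-1))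
        (𝓝 ((upperGrowth (-1) : ℝ) : ℂ)) :=
      (continuous_ofReal.tendsto _).comp (hc.tendsto.mono_left nhdsWithin_le_nhds)
    refine mem_closure_of_tendsto ht ?_
    filter_upwards [Ioo_mem_nhdsGT (show (-1 : ℝ) < 1 by norm_num)] with r hr
    refine ⟨r, ?_, extremal_ofReal hr.2⟩
    rw [mem_unitDisc, norm_real, Real.norm_eq_abs, abs_lt]
    exact hr
  have hfr : ((upperGrowth (-1) : ℝ) : ℂ) ∈ frontier (extremal '' unitDisc) :=
    ⟨hcl, fun h => hnot (interior_subset h)⟩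
  refine (infDist_le_dist_of_mem hfr).trans ?_
  rw [isClassC1_extremal.map_zero, dist_zero_left, norm_real, hneg1, norm_neg,
    Real.norm_of_nonneg (by linarith)]

/-! ### The radius equation and the Bohr–Rogosinski sum. -/

/-- The left-hand side of the equation for the radius. -/
noncomputable def radiusFunction (N : ℕ) (r : ℝ) : ℝ :=
  upperGrowth r ^ 2 + ∑' k : ℕ, (2 - 1 / ((N + k : ℕ) : ℝ)) * r ^ (N + k)

lemma isRadiusEquation_iff {N : ℕ} {r : ℝ} :
    IsRadiusEquation N r ↔ radiusFunction N r = 1 - Real.log 2 := Iff.rfl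

section Radius

variable {N : ℕ}

lemma summable_tail (hN : N ≠ 0) {r : ℝ} (hr0 : 0 ≤ r) (hr : r < 1) :
    Summable fun k : ℕ => (2 - 1 / ((N + k : ℕ) : ℝ)) * r ^ (N + k) := by
  have h := (hasSum_upperGrowth hr0 hr).summable.comp_injective (add_right_injective N)
  refine h.congr fun k => ?_
  simp only [Function.comp]
  rw [extremalCoeff_of_ne_zero (by omega)]

lemma two_sub_nonneg (hN : N ≠ 0) (k : ℕ) : 0 ≤ 2 - 1 / ((N + k : ℕ) : ℝ) := by
  rw [← extremalCoeff_of_ne_zero (show N + k ≠ 0 by omega)]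
  exact extremalCoeff_nonneg _

lemma upperGrowth_nonneg {r : ℝ} (hr0 : 0 ≤ r) (hr : r < 1) : 0 ≤ upperGrowth r := by
  rw [← upperGrowth_zero]
  exact strictMonoOn_upperGrowth.monotoneOn (by norm_num) ⟨by linarith, hr⟩ hr0

lemma strictMonoOn_radiusFunction (hN : N ≠ 0) : StrictMonoOn (radiusFunction N) (Ico 0 1) := by
  intro x hx y hy hxy
  have h1 : upperGrowth x < upperGrowth y :=
    strictMonoOn_upperGrowth ⟨by linarith [hx.1], hx.2⟩ ⟨by linarith [hy.1], hy.2⟩ hxy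
  refine add_lt_add_of_lt_of_le
    (pow_lt_pow_left₀ h1 (upperGrowth_nonneg hx.1 hx.2) two_ne_zero) ?_
  refine (summable_tail hN hx.1 hx.2).tsum_le_tsum (fun k => ?_) (summable_tail hN hy.1 hy.2)
  exact mul_le_mul_of_nonneg_left (pow_le_pow_left₀ hx.1 hxy.le _) (two_sub_nonneg hN k)

lemma radiusFunction_zero (hN : N ≠ 0) : radiusFunction N 0 = 0 := by
  simp [radiusFunction, upperGrowth_zero, hN]

lemma continuousOn_radiusFunction (hN : N ≠ 0) :
    ContinuousOn (radiusFunction N) (Icc 0 (1 / 2)) := by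
  refine ContinuousOn.add (ContinuousOn.pow ?_ 2) ?_
  · unfold upperGrowth
    have : ∀ r ∈ Icc (0 : ℝ) (1 / 2), 1 - r ≠ 0 := fun r hr => by linarith [hr.2]
    exact ContinuousOn.add (ContinuousOn.div (by fun_prop) (by fun_prop) this)
      (ContinuousOn.log (by fun_prop) this)
  · refine continuousOn_tsum (fun k => by fun_prop)
      (summable_tail hN (r := 1 / 2) (by norm_num) (by norm_num)) fun k r hr => ?_
    rw [norm_mul, norm_pow, Real.norm_of_nonneg (two_sub_nonneg hN k),
      Real.norm_of_nonneg hr.1]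
    exact mul_le_mul_of_nonneg_left (pow_le_pow_left₀ hr.1 hr.2 _) (two_sub_nonneg hN k)

lemma existsUnique_radius (hN : N ≠ 0) :
    ∃! r : ℝ, r ∈ Ioo (0 : ℝ) 1 ∧ IsRadiusEquation N r := by
  have hlog := log_two_lt_one
  have hlog0 : 0 < Real.log 2 := Real.log_pos (by norm_num)
  -- The squared term alone suffices at 1/2, as (2 - log 2)² ≥ 1 - log 2; hence continuity is needed
  -- only on [0, 1/2].
  have hhalf : 1 - Real.log 2 ≤ radiusFunction N (1 / 2) := by
    have h1 : upperGrowth (1 / 2) = 2 - Real.log 2 := by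
      have : (1 : ℝ) - 1 / 2 = 2⁻¹ := by norm_num
      rw [upperGrowth, this, Real.log_inv]
      norm_num
      ring
    have h2 : 0 ≤ ∑' k : ℕ, (2 - 1 / ((N + k : ℕ) : ℝ)) * (1 / 2 : ℝ) ^ (N + k) :=
      tsum_nonneg fun k => mul_nonneg (two_sub_nonneg hN k) (by positivity)
    rw [radiusFunction, h1]
    nlinarith
  obtain ⟨r, hr, he⟩ := intermediate_value_Icc (by norm_num) (continuousOn_radiusFunction hN)
    (show 1 - Real.log 2 ∈ Icc (radiusFunction N 0) (radiusFunction N (1 / 2)) from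
      ⟨by rw [radiusFunction_zero hN]; linarith, hhalf⟩)
  have hr0 : 0 < r := by
    refine lt_of_le_of_ne hr.1 fun h => ?_
    rw [← h, radiusFunction_zero hN] at he
    linarith
  refine ⟨r, ⟨⟨hr0, by linarith [hr.2]⟩, he⟩, ?_⟩
  rintro s ⟨hs, hse⟩
  exact (strictMonoOn_radiusFunction hN).injOn ⟨hs.1.le, hs.2⟩ ⟨hr0.le, by linarith [hr.2]⟩
    ((isRadiusEquation_iff.1 hse).trans he.symm)

/-- The upper bound for the Bohr–Rogosinski sum on the class `C₁`. -/
lemma IsClassC1.bohrRogosinskiSum_le {f : ℂ → ℂ} (hf : IsClassC1 f) (hN : N ≠ 0) {z : ℂ}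
    (hz : z ∈ unitDisc) :
    Summable (fun k : ℕ => ‖taylorCoeff f (N + k)‖ * ‖z‖ ^ (N + k)) ∧
      bohrRogosinskiSum f N z ≤ radiusFunction N ‖z‖ := by
  have hz1 := mem_unitDisc.1 hz
  have hterm : ∀ k : ℕ, ‖taylorCoeff f (N + k)‖ * ‖z‖ ^ (N + k) ≤
      (2 - 1 / ((N + k : ℕ) : ℝ)) * ‖z‖ ^ (N + k) := fun k =>
    mul_le_mul_of_nonneg_right (hf.norm_taylorCoeff_le (by omega)) (by positivity)
  have hs := summable_tail hN (norm_nonneg z) hz1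
  have hs' : Summable (fun k : ℕ => ‖taylorCoeff f (N + k)‖ * ‖z‖ ^ (N + k)) :=
    hs.of_nonneg_of_le (fun k => by positivity) hterm
  refine ⟨hs', add_le_add (pow_le_pow_left₀ (norm_nonneg _) ?_ 2) (hs'.tsum_le_tsum hterm hs)⟩
  rw [← (hasSum_taylorCoeff hf.analytic hz).tsum_eq]
  refine tsum_of_norm_bounded (hasSum_upperGrowth (norm_nonneg z) hz1) fun n => ?_
  rw [norm_mul, norm_pow]
  refine mul_le_mul_of_nonneg_right ?_ (by positivity)
  by_cases hn : n = 0
  · rw [hn, taylorCoeff_zero, hf.map_zero, norm_zero]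
    exact extremalCoeff_nonneg 0
  · rw [extremalCoeff_of_ne_zero hn]
    exact hf.norm_taylorCoeff_le hn

/-- On the positive axis all terms are nonnegative, so taking norms loses nothing. -/
lemma bohrRogosinskiSum_extremal (hN : N ≠ 0) {r : ℝ} (hr0 : 0 ≤ r) (hr : r < 1) :
    bohrRogosinskiSum extremal N r = radiusFunction N r := by
  rw [bohrRogosinskiSum, radiusFunction, extremal_ofReal hr, norm_real, norm_real,
    Real.norm_of_nonneg hr0, Real.norm_of_nonneg (upperGrowth_nonneg hr0 hr)]
  congr 1
  refine tsum_congr fun k => ?_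
  rw [taylorCoeff_extremal, norm_real, Real.norm_of_nonneg (extremalCoeff_nonneg _),
    extremalCoeff_of_ne_zero (by omega)]

end Radius

end BohrRogosinski

theorem mainTheorem4 (N : ℕ) (hN : 2 ≤ N) :
    (∃! r : ℝ, r ∈ Set.Ioo (0 : ℝ) 1 ∧ BohrRogosinski.IsRadiusEquation N r) ∧
    ∀ r : ℝ, r ∈ Set.Ioo (0 : ℝ) 1 → BohrRogosinski.IsRadiusEquation N r →
      (∀ f : ℂ → ℂ, BohrRogosinski.IsClassC1 f → ∀ z : ℂ, ‖z‖ ≤ r →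
        Summable (fun k : ℕ => ‖BohrRogosinski.taylorCoeff f (N + k)‖ * ‖z‖ ^ (N + k)) ∧
        BohrRogosinski.bohrRogosinskiSum f N z ≤ BohrRogosinski.boundaryDist f) ∧
      (∃ f : ℂ → ℂ, BohrRogosinski.IsClassC1 f ∧
        (∃ z : ℂ, ‖z‖ = r ∧
          BohrRogosinski.bohrRogosinskiSum f N z = BohrRogosinski.boundaryDist f) ∧
        (∀ ρ : ℝ, r < ρ → ρ < 1 → ∃ z : ℂ, ‖z‖ = ρ ∧
          BohrRogosinski.boundaryDist f < BohrRogosinski.bohrRogosinskiSum f N z)) := by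
  open BohrRogosinski in
  have hN0 : N ≠ 0 := by omega
  refine ⟨existsUnique_radius hN0, fun r hr hre => ⟨fun f hf z hz => ?_,
    extremal, isClassC1_extremal, ⟨r, ?_, ?_⟩, fun ρ hρ hρ1 => ⟨ρ, ?_, ?_⟩⟩⟩
  · obtain ⟨h1, h2⟩ := hf.bohrRogosinskiSum_le hN0 (mem_unitDisc.2 (hz.trans_lt hr.2))
    refine ⟨h1, h2.trans (le_trans ?_ hf.le_boundaryDist)⟩
    rw [← isRadiusEquation_iff.1 hre]
    exact (strictMonoOn_radiusFunction hN0).monotoneOn ⟨norm_nonneg _, hz.trans_lt hr.2⟩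
      ⟨hr.1.le, hr.2⟩ hz
  · rw [Complex.norm_real, Real.norm_of_nonneg hr.1.le]
  · rw [bohrRogosinskiSum_extremal hN0 hr.1.le hr.2, isRadiusEquation_iff.1 hre,
      boundaryDist_extremal]
  · rw [Complex.norm_real, Real.norm_of_nonneg (hr.1.trans hρ).le]
  · rw [bohrRogosinskiSum_extremal hN0 (hr.1.trans hρ).le hρ1, boundaryDist_extremal,
      ← isRadiusEquation_iff.1 hre]
    exact strictMonoOn_radiusFunction hN0 ⟨hr.1.le, hr.2⟩ ⟨(hr.1.trans hρ).le, hρ1⟩ hρ
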